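/- Let $n\ge 0$ agents have valuations drawn i.i.d. from a distribution with support $[a,b]$, $0\le a<b<\infty$, with cumulative distribution function $F$ and a (measurable) density $f$ that is positive on $[a,b]$. Let $\mathcal X\subseteq\{0,1\}^n$ be an arbitrary set of feasible allocation vectors. A (direct, possibly randomized) mechanism maps a valuation profile $\mathbf v$, together with an independent random seed $\omega$ from a fixed probability space (a one-point space for deterministic mechanisms), to an allocation $\mathbf x(\mathbf v,\omega)\in\mathcal X$ and burnt payments $\mathbf p(\mathbf v,\omega)\in[0,\infty)^n$. Write $x_i(v)$ and $p_i(v)$ for the expected allocation and the expected payment (assumed finite) of agent $i$ when it reports $v$ and the others report truthfully. Mechanisms are required to be Bayesian incentive compatible, $v\,x_i(v)-p_i(v)\ge v\,x_i(v')-p_i(v')$ for all $i$ and $v,v'\in[a,b]$; interim individually rational, $v\,x_i(v)-p_i(v)\ge 0$ for all $i$ and $v\in[a,b]$; and normalized so that the lowest type has utility $a\,x_i(a)-p_i(a)=0$ for all $i$ (this is automatic when $a=0$). Let $\vartheta(z)=\frac{1-F(z)}{f(z)}$, $h(q)=\vartheta(F^{-1}(q))$ and $H(q)=\int_0^q h(r)\,dr$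 for $q\in[0,1]$, let $G$ be the largest convex function on $[0,1]$ with $G\le H$, let $g$ be the derivative of $G$, extended to $[0,1)$ by right-continuity and to $1$ by the left derivative, and let $\bar\vartheta(z)=g(F(z))$. Then a mechanism maximizes the expected residual surplus $\mathbf E\big[\sum_i (v_i x_i(\mathbf v,\omega)-p_i(\mathbf v,\omega))\big]$ among all such mechanisms if and only if 1. for almost every $(\mathbf v,\omega)$, $\mathbf x(\mathbf v,\omega)\in\operatorname{argmax}_{\mathbf x'\in\mathcal X}\sum_i\bar\vartheta(v_i)\,x'_i$; and 2. for all $i$ and all $v\in[a,b]$ with $G(F(v))<H(F(v))$, the derivative $\frac{d}{dv}x_i(v)$ exists and equals $0$. -/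

import Mathlib

open MeasureTheory

noncomputable section

namespace MoneyBurning

/-! ### Ironing

`μ` is the valuation distribution, with cumulative distribution function `ProbabilityTheory.cdf μ`
and density `f` on the support `[a, b]`. -/

/-- Virtual valuation for utility `ϑ(z) = (1 - F(z)) / f(z)`. -/
def virtualVal (μ : Measure ℝ) (f : ℝ → ℝ) (z : ℝ) : ℝ :=
  (1 - ProbabilityTheory.cdf μ z) / f z

/-- The inverse `F⁻¹ : [0, 1] → [a, b]` of the distribution function on the support. -/
def cdfInv (μ : Measure ℝ) (a b : ℝ) (q : ℝ) : ℝ :=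
  Function.invFunOn (ProbabilityTheory.cdf μ) (Set.Icc a b) q

/-- `h(q) = ϑ(F⁻¹(q))`. -/
def hFun (μ : Measure ℝ) (f : ℝ → ℝ) (a b : ℝ) (q : ℝ) : ℝ :=
  virtualVal μ f (cdfInv μ a b q)

/-- `H(q) = ∫₀^q h(r) dr`. -/
def HFun (μ : Measure ℝ) (f : ℝ → ℝ) (a b : ℝ) (q : ℝ) : ℝ :=
  ∫ r in (0 : ℝ)..q, hFun μ f a b r

/-- The convex hull on `[0, 1]` of a function `H`: the pointwise largest convex function on `[0, 1]`
that is bounded above by `H` there (only its values on `[0, 1]` are meaningful). -/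
def convexHullFun (H : ℝ → ℝ) (q : ℝ) : ℝ :=
  sSup {y : ℝ | ∃ φ : ℝ → ℝ,
    ConvexOn ℝ (Set.Icc 0 1) φ ∧ (∀ r ∈ Set.Icc (0 : ℝ) 1, φ r ≤ H r) ∧ y = φ q}

/-- `G`, the convex hull of `H`. -/
def GFun (μ : Measure ℝ) (f : ℝ → ℝ) (a b : ℝ) : ℝ → ℝ :=
  convexHullFun (HFun μ f a b)

/-- `g`, the derivative of `G` extended by right-continuity. For a convex function this is the right
derivative; at the endpoint `q = 1` of the domain it is the left derivative. -/
def gFun (μ : Measure ℝ) (f : ℝ → ℝ) (a b : ℝ) (q : ℝ) : ℝ :=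
  if q < 1 then derivWithin (GFun μ f a b) (Set.Ioi q) q
  else derivWithin (GFun μ f a b) (Set.Iio q) q

/-- The ironed virtual valuation for utility `z ↦ g(F(z))`. -/
def ironedVal (μ : Measure ℝ) (f : ℝ → ℝ) (a b : ℝ) (z : ℝ) : ℝ :=
  gFun μ f a b (ProbabilityTheory.cdf μ z)

/-! ### Mechanisms -/

/-- A direct, possibly randomized, mechanism for `n` agents: from the reported valuation profile `v`
and the random seed `ω` it computes an allocation vector and a vector of (burnt) payments.
Deterministic mechanisms are those with a one-point seed space. -/
structure Mechanism (n : ℕ) (Ω : Type*) where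
  alloc : (Fin n → ℝ) → Ω → Fin n → ℝ
  pay : (Fin n → ℝ) → Ω → Fin n → ℝ

namespace Mechanism

variable {n : ℕ} {Ω : Type*} [MeasurableSpace Ω]

/-- The joint law of an i.i.d. valuation profile and of the independent seed. -/
def jointLaw (n : ℕ) (μ : Measure ℝ) (P : Measure Ω) : Measure ((Fin n → ℝ) × Ω) :=
  (Measure.pi fun _ : Fin n => μ).prod P

/-- Interim allocation `x_i(z)`: the probability that agent `i` is served when its valuation is `z`
(the `i`-th coordinate of the random profile is overwritten by `z`). -/
def interimAlloc (M : Mechanism n Ω) (μ : Measure ℝ) (P : Measure Ω) (i : Fin n) (z : ℝ) : ℝ :=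
  ∫ q, M.alloc (Function.update q.1 i z) q.2 i ∂(jointLaw n μ P)

/-- Interim payment `p_i(z)`. -/
def interimPay (M : Mechanism n Ω) (μ : Measure ℝ) (P : Measure Ω) (i : Fin n) (z : ℝ) : ℝ :=
  ∫ q, M.pay (Function.update q.1 i z) q.2 i ∂(jointLaw n μ P)

/-- Interim utility of agent `i` with valuation `z` who reports `z'`. -/
def interimUtil (M : Mechanism n Ω) (μ : Measure ℝ) (P : Measure Ω) (i : Fin n) (z z' : ℝ) : ℝ :=
  z * M.interimAlloc μ P i z' - M.interimPay μ P i z'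

/-- Expected residual surplus `E[∑ᵢ (vᵢ xᵢ(v) - pᵢ(v))]`. -/
def residualSurplus (M : Mechanism n Ω) (μ : Measure ℝ) (P : Measure Ω) : ℝ :=
  ∫ q, ∑ i, (q.1 i * M.alloc q.1 q.2 i - M.pay q.1 q.2 i) ∂(jointLaw n μ P)

/-- The Bayesian incentive compatible mechanisms for the type space `[a, b]` and the set `X` of
feasible allocation vectors. -/
structure IsAdmissible (M : Mechanism n Ω) (μ : Measure ℝ) (P : Measure Ω) (a b : ℝ)
    (X : Set (Fin n → ℝ)) : Prop where
  measurable_alloc : ∀ i, Measurable fun q : (Fin n → ℝ) × Ω => M.alloc q.1 q.2 i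
  measurable_pay : ∀ i, Measurable fun q : (Fin n → ℝ) × Ω => M.pay q.1 q.2 i
  /-- The chosen allocation is always feasible. -/
  feasible : ∀ v ω, M.alloc v ω ∈ X
  /-- No positive transfers to the agents. -/
  pay_nonneg : ∀ v ω i, 0 ≤ M.pay v ω i
  /-- Every type has a finite interim payment. -/
  integrable_pay : ∀ i, ∀ z ∈ Set.Icc a b,
    Integrable (fun q : (Fin n → ℝ) × Ω => M.pay (Function.update q.1 i z) q.2 i) (jointLaw n μ P)
  /-- Truthtelling is a Bayes-Nash equilibrium. -/
  incentive_compatible : ∀ i, ∀ z ∈ Set.Icc a b, ∀ z' ∈ Set.Icc a b,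
    M.interimUtil μ P i z z' ≤ M.interimUtil μ P i z z
  /-- Interim individual rationality. -/
  individually_rational : ∀ i, ∀ z ∈ Set.Icc a b, 0 ≤ M.interimUtil μ P i z z
  /-- The usual normalization of payments: the lowest type has interim utility zero. When `a = 0`
  this is implied by the other conditions, see `interimUtil_zero`. -/
  lowest_type : ∀ i, M.interimUtil μ P i a a = 0

/-- For `a = 0` the normalization of the lowest type is no restriction: it follows from
nonnegativity of the payments and individual rationality. -/
theorem interimUtil_zero (M : Mechanism n Ω) (μ : Measure ℝ) (P : Measure Ω)
    (hpay : ∀ v ω i, 0 ≤ M.pay v ω i) (i : Fin n) (hir : 0 ≤ M.interimUtil μ P i 0 0) :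
    M.interimUtil μ P i 0 0 = 0 := by
  have h : 0 ≤ M.interimPay μ P i 0 := integral_nonneg fun q => hpay _ _ _
  unfold interimUtil at *
  linarith

/-- `M` maximizes the expected residual surplus among all admissible mechanisms. -/
def IsOptimal (M : Mechanism n Ω) (μ : Measure ℝ) (P : Measure Ω) (a b : ℝ)
    (X : Set (Fin n → ℝ)) : Prop :=
  M.IsAdmissible μ P a b X ∧
    ∀ M' : Mechanism n Ω, M'.IsAdmissible μ P a b X →
      M'.residualSurplus μ P ≤ M.residualSurplus μ P

end Mechanism

end MoneyBurning

end

/-! Incentive compatibility says that the interim utility of an agent has the interim allocation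
`x_i` as a subgradient, so `x_i` is monotone and utility is its primitive, starting from zero at
`a`. Fubini then turns expected utility into `∫ ϑ x_i dμ`, and payments disappear from the
objective.

Write `ϑ = ϑ̄ + (ϑ - ϑ̄)`. The residual surplus becomes the expected ironed surplus `E[∑ ϑ̄(v_i)
x_i]` plus one correction `∫ (ϑ - ϑ̄) x_i dμ` per agent. A monotone `x_i` is an average of step
functions `1_{z > c}`. On such a step the correction equals `-(H - G)(F(c))`, because `G(1) = H(1)`.
Hence each correction is nonpositive (`integral_virtualVal_sub_mul`). It vanishes exactly when
almost no level of `x_i` is crossed where `G < H`, that is, when `x_i` is locally constant there.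

So two bounds hold: the ironed surplus is at most its pointwise maximum, and the corrections are at
most zero. They can be attained together (`exists_isAdmissible_residualSurplus_eq`). Choose a
pointwise maximizer with ties broken by a rule that sees the reports only through the comparison of
allocations. It is monotone in each agent's report because `ϑ̄` is monotone, hence implementable by
envelope payments. Moreover `G` is affine wherever `G < H` (`exists_convexHullFun_eq_affine`), so
`ϑ̄`, and with it `x_i`, is locally constant there. A mechanism is therefore optimal if and only if
both bounds are tight for it, and these are the two stated conditions. -/

noncomputable section

namespace MoneyBurning

open Set Filter Topology ProbabilityTheory

/-! ### The convex hull of a function on `[0, 1]` -/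

section ConvexHull

variable {H : ℝ → ℝ}

/-- Nonnegativity of `H` makes the zero function a competitor, so the supremum runs over a nonempty
set and does not take a default value. -/
theorem convexHullFun_le (h0 : ∀ r ∈ Icc (0 : ℝ) 1, 0 ≤ H r) {q : ℝ} (hq : q ∈ Icc (0 : ℝ) 1) :
    convexHullFun H q ≤ H q := by
  refine csSup_le ⟨0, fun _ => 0, convexOn_const 0 (convex_Icc 0 1), h0, rfl⟩ ?_
  rintro y ⟨φ, -, hφ, rfl⟩
  exact hφ q hq

theorem le_convexHullFun {φ : ℝ → ℝ} (hφ : ConvexOn ℝ (Icc 0 1) φ)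
    (hle : ∀ r ∈ Icc (0 : ℝ) 1, φ r ≤ H r) {q : ℝ} (hq : q ∈ Icc (0 : ℝ) 1) :
    φ q ≤ convexHullFun H q := by
  refine le_csSup ⟨H q, ?_⟩ ⟨φ, hφ, hle, rfl⟩
  rintro y ⟨ψ, -, hψ, rfl⟩
  exact hψ q hq

theorem convexHullFun_nonneg (h0 : ∀ r ∈ Icc (0 : ℝ) 1, 0 ≤ H r) {q : ℝ}
    (hq : q ∈ Icc (0 : ℝ) 1) : 0 ≤ convexHullFun H q :=
  le_convexHullFun (φ := fun _ => 0) (convexOn_const 0 (convex_Icc 0 1)) h0 hq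

theorem convexOn_convexHullFun (h0 : ∀ r ∈ Icc (0 : ℝ) 1, 0 ≤ H r) :
    ConvexOn ℝ (Icc 0 1) (convexHullFun H) := by
  refine ⟨convex_Icc 0 1, fun x hx y hy s t hs ht hst => ?_⟩
  refine csSup_le ⟨0, fun _ => 0, convexOn_const 0 (convex_Icc 0 1), h0, rfl⟩ ?_
  rintro z ⟨φ, hφ, hle, rfl⟩
  refine (hφ.2 hx hy hs ht hst).trans ?_
  simp only [smul_eq_mul]
  gcongr
  · exact le_convexHullFun hφ hle hx
  · exact le_convexHullFun hφ hle hy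

theorem convexOn_affine (s : Set ℝ) (hs : Convex ℝ s) (k c : ℝ) :
    ConvexOn ℝ s fun q => k * q + c := by
  refine ⟨hs, fun x _ y _ s t _ _ hst => le_of_eq ?_⟩
  simp only [smul_eq_mul]
  linear_combination -c * hst

/-- A line of value `H 1 - ε` at `1`: within `δ` of `1`, continuity keeps it below `H`; farther
away, the slope `|H 1| / δ` has pushed it below `0 ≤ H`. -/
theorem exists_affine_le_of_continuousOn (hc : ContinuousOn H (Icc 0 1))
    (h0 : ∀ r ∈ Icc (0 : ℝ) 1, 0 ≤ H r) {ε : ℝ} (hε : 0 < ε) :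
    ∃ k : ℝ, ∀ r ∈ Icc (0 : ℝ) 1, k * r + (H 1 - ε - k) ≤ H r := by
  have h1 : (1 : ℝ) ∈ Icc (0 : ℝ) 1 := ⟨zero_le_one, le_rfl⟩
  obtain ⟨δ, hδ, hd⟩ := Metric.continuousWithinAt_iff.1 (hc 1 h1) ε hε
  refine ⟨|H 1| / δ, fun r hr => ?_⟩
  have hk : 0 ≤ |H 1| / δ := by positivity
  by_cases hrd : dist r 1 < δ
  · have := hd hr hrd
    rw [Real.dist_eq, abs_lt] at this
    nlinarith [hr.2]
  · rw [Real.dist_eq, abs_of_nonpos (by linarith [hr.2])] at hrd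
    have h2 : |H 1| / δ * δ = |H 1| := by field_simp
    have h3 : |H 1| / δ * δ ≤ |H 1| / δ * (1 - r) := by gcongr; linarith
    nlinarith [h0 r hr, le_abs_self (H 1)]

theorem convexHullFun_zero (h0 : ∀ r ∈ Icc (0 : ℝ) 1, 0 ≤ H r) (hz : H 0 = 0) :
    convexHullFun H 0 = 0 :=
  le_antisymm ((convexHullFun_le h0 ⟨le_rfl, zero_le_one⟩).trans hz.le)
    (convexHullFun_nonneg h0 ⟨le_rfl, zero_le_one⟩)

theorem convexHullFun_one (hc : ContinuousOn H (Icc 0 1)) (h0 : ∀ r ∈ Icc (0 : ℝ) 1, 0 ≤ H r) :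
    convexHullFun H 1 = H 1 := by
  have h1 : (1 : ℝ) ∈ Icc (0 : ℝ) 1 := ⟨zero_le_one, le_rfl⟩
  refine le_antisymm (convexHullFun_le h0 h1) (le_of_forall_pos_le_add fun ε hε => ?_)
  obtain ⟨k, hk⟩ := exists_affine_le_of_continuousOn hc h0 hε
  have := le_convexHullFun (convexOn_affine _ (convex_Icc 0 1) k (H 1 - ε - k)) hk h1
  linarith

/-- Convexity gives continuity only in the interior. At `0` the hull is squeezed between `0` and
`H`, at `1` between a steep affine minorant and `H`. -/
theorem continuousOn_convexHullFun (hc : ContinuousOn H (Icc 0 1))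
    (h0 : ∀ r ∈ Icc (0 : ℝ) 1, 0 ≤ H r) (hz : H 0 = 0) :
    ContinuousOn (convexHullFun H) (Icc 0 1) := by
  intro q hq
  rcases eq_or_lt_of_le hq.1 with rfl | hq0
  · have : Tendsto H (𝓝[Icc 0 1] 0) (𝓝 0) := by
      have := hc 0 hq
      rwa [ContinuousWithinAt, hz] at this
    rw [ContinuousWithinAt, convexHullFun_zero h0 hz]
    refine tendsto_of_tendsto_of_tendsto_of_le_of_le' tendsto_const_nhds this ?_ ?_
    · filter_upwards [self_mem_nhdsWithin] with r hr using convexHullFun_nonneg h0 hr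
    · filter_upwards [self_mem_nhdsWithin] with r hr using convexHullFun_le h0 hr
  rcases eq_or_lt_of_le hq.2 with rfl | hq1
  · rw [ContinuousWithinAt, convexHullFun_one hc h0, Metric.tendsto_nhds]
    intro ε hε
    obtain ⟨k, hk⟩ := exists_affine_le_of_continuousOn hc h0 (half_pos hε)
    have hl : Tendsto (fun r => k * r + (H 1 - ε / 2 - k)) (𝓝[Icc 0 1] 1)
        (𝓝 (k * 1 + (H 1 - ε / 2 - k))) := by
      apply Continuous.continuousWithinAt; fun_prop
    filter_upwards [self_mem_nhdsWithin,
      (hc 1 hq).eventually (gt_mem_nhds (show H 1 < H 1 + ε by linarith)),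
      hl.eventually (lt_mem_nhds (show H 1 - ε < _ by linarith))] with r hr hr1 hr2
    have h1 := convexHullFun_le h0 hr
    have h2 := le_convexHullFun (convexOn_affine _ (convex_Icc 0 1) k (H 1 - ε / 2 - k)) hk hr
    rw [Real.dist_eq, abs_lt]
    constructor <;> linarith
  · have := (convexOn_convexHullFun h0).continuousOn_interior
    rw [interior_Icc] at this
    exact (this.continuousAt (Ioo_mem_nhds hq0 hq1)).continuousWithinAt

/-- The convex hull is affine near every point at which it is strictly below the function. -/
theorem exists_convexHullFun_eq_affine (hc : ContinuousOn H (Icc 0 1))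
    (h0 : ∀ r ∈ Icc (0 : ℝ) 1, 0 ≤ H r) (hz : H 0 = 0) {q : ℝ} (hq : q ∈ Ioo (0 : ℝ) 1)
    (hlt : convexHullFun H q < H q) :
    ∃ k c δ : ℝ, 0 < δ ∧ ∀ r ∈ Ioo (q - δ) (q + δ),
      r ∈ Ioo (0 : ℝ) 1 ∧ convexHullFun H r = k * r + c := by
  set G := convexHullFun H with hG
  have hGc := continuousOn_convexHullFun hc h0 hz
  have hGx := convexOn_convexHullFun h0
  have hn : Icc (0 : ℝ) 1 ∈ 𝓝 q := Icc_mem_nhds hq.1 hq.2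
  obtain ⟨m, hm1, hm2⟩ := exists_between hlt
  have hev : ∀ᶠ r in 𝓝 q, G r < m ∧ m < H r ∧ r ∈ Ioo (0 : ℝ) 1 := by
    filter_upwards [(hGc.continuousAt hn).eventually (gt_mem_nhds hm1),
      (hc.continuousAt hn).eventually (lt_mem_nhds hm2), Ioo_mem_nhds hq.1 hq.2] with r h1 h2 h3
    exact ⟨h1, h2, h3⟩
  obtain ⟨ε, hε, hball⟩ := Metric.eventually_nhds_iff.1 hev
  have hin : ∀ r, |r - q| < ε → G r < m ∧ m < H r ∧ r ∈ Ioo (0 : ℝ) 1 := fun r hr =>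
    hball (by rwa [Real.dist_eq])
  set δ := ε / 2 with hδ
  have hδ0 : 0 < δ := half_pos hε
  have hP := hin (q - δ) (by rw [abs_lt]; constructor <;> linarith)
  have hR := hin (q + δ) (by rw [abs_lt]; constructor <;> linarith)
  set p := q - δ with hp
  set r₁ := q + δ with hr₁
  have hpr : p < r₁ := by linarith
  set k := (G r₁ - G p) / (r₁ - p) with hk
  have hkm : k * (r₁ - p) = G r₁ - G p := by
    rw [hk]; field_simp [sub_ne_zero.2 hpr.ne']
  set c := G p - k * p with hc'
  have hchord_le : ∀ r ∈ Icc p r₁, G r ≤ k * r + c := by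
    intro r hr
    have h := hGx.2 (Ioo_subset_Icc_self hP.2.2) (Ioo_subset_Icc_self hR.2.2)
      (show 0 ≤ (r₁ - r) / (r₁ - p) from div_nonneg (by linarith [hr.2]) (by linarith))
      (show 0 ≤ (r - p) / (r₁ - p) from div_nonneg (by linarith [hr.1]) (by linarith))
      (by field_simp [sub_ne_zero.2 hpr.ne']; ring)
    simp only [smul_eq_mul] at h
    have hne := sub_ne_zero.2 hpr.ne'
    have e1 : (r₁ - r) / (r₁ - p) * p + (r - p) / (r₁ - p) * r₁ = r := by field_simp; ring
    have e2 : (r₁ - r) / (r₁ - p) * G p + (r - p) / (r₁ - p) * G r₁ = k * r + c := by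
      rw [hc', hk]; field_simp; ring
    rw [e1, e2] at h
    exact h
  have hchord_ge : ∀ r ∈ Icc (0 : ℝ) 1, r ∉ Icc p r₁ → k * r + c ≤ G r := by
    intro r hr hnr
    rcases lt_or_ge r p with hrp | hrp
    · have h := hGx.slope_mono_adjacent hr (Ioo_subset_Icc_self hR.2.2) hrp hpr
      rw [← hk, div_le_iff₀ (by linarith)] at h
      rw [hc']; linarith
    · have hrr : r₁ < r := by
        by_contra hcon; exact hnr ⟨hrp, not_lt.1 hcon⟩
      have h := hGx.slope_mono_adjacent (Ioo_subset_Icc_self hP.2.2) hr hpr hrr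
      rw [← hk, le_div_iff₀ (by linarith)] at h
      rw [hc']; linarith
  -- On `[p, r₁]` the chord stays below the level `m < H`, since its endpoint values do; outside, it
  -- lies below `G` by convexity. So its maximum with `G` is a convex minorant of `H` and cannot
  -- exceed `G`.
  have hle : ∀ r ∈ Icc (0 : ℝ) 1, max (G r) (k * r + c) ≤ H r := by
    intro r hr
    refine max_le (convexHullFun_le h0 hr) ?_
    by_cases hmem : r ∈ Icc p r₁
    · have h1 : m < H r := (hin r (by rw [abs_lt]; constructor <;> linarith [hmem.1, hmem.2])).2.1
      have e : (k * r + c) * (r₁ - p) = G p * (r₁ - r) + G r₁ * (r - p) := by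
        rw [hc']; linear_combination (r - p) * hkm
      have : (k * r + c) * (r₁ - p) ≤ m * (r₁ - p) := by
        rw [e]; nlinarith [hmem.1, hmem.2, hP.1, hR.1]
      exact (le_of_mul_le_mul_right this (by linarith)).trans h1.le
    · exact (hchord_ge r hr hmem).trans (convexHullFun_le h0 hr)
  refine ⟨k, c, δ, hδ0, fun r hr => ?_⟩
  have hr01 := (hin r (by rw [abs_lt]; constructor <;> linarith [hr.1, hr.2])).2.2
  refine ⟨hr01, le_antisymm (hchord_le r ⟨hr.1.le, hr.2.le⟩) ?_⟩
  have hsup := hGx.sup (convexOn_affine _ (convex_Icc 0 1) k c)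
  exact (le_max_right _ _).trans (le_convexHullFun hsup hle (Ioo_subset_Icc_self hr01))

end ConvexHull

/-! ### The valuation distribution -/

/-- `μ` is the law with density `f`, positive on `[a, b]`, and support `[a, b]`. -/
structure IsValuationLaw (μ : Measure ℝ) (f : ℝ → ℝ) (a b : ℝ) : Prop where
  lt : a < b
  measurable_density : Measurable f
  density_pos : ∀ z ∈ Icc a b, 0 < f z
  eq_withDensity : μ = (volume.restrict (Icc a b)).withDensity fun z => ENNReal.ofReal (f z)

namespace IsValuationLaw

variable {μ : Measure ℝ} {f : ℝ → ℝ} {a b : ℝ}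

theorem absolutelyContinuous (h : IsValuationLaw μ f a b) : μ ≪ volume.restrict (Icc a b) := by
  rw [h.eq_withDensity]
  exact withDensity_absolutelyContinuous _ _

theorem measure_singleton (h : IsValuationLaw μ f a b) (z : ℝ) : μ {z} = 0 :=
  h.absolutelyContinuous (by simp)

theorem ae_mem_Ioo (h : IsValuationLaw μ f a b) : ∀ᵐ z ∂μ, z ∈ Ioo a b := by
  have h1 : ∀ᵐ z ∂μ, z ∈ Icc a b :=
    h.absolutelyContinuous.ae_le (ae_restrict_mem measurableSet_Icc)
  have h2 : ∀ᵐ z ∂μ, z ≠ a := by simp [ae_iff, h.measure_singleton]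
  have h3 : ∀ᵐ z ∂μ, z ≠ b := by simp [ae_iff, h.measure_singleton]
  filter_upwards [h1, h2, h3] with z hz ha hb
  exact ⟨lt_of_le_of_ne hz.1 (Ne.symm ha), lt_of_le_of_ne hz.2 hb⟩

theorem ae_mem_Icc (h : IsValuationLaw μ f a b) : ∀ᵐ z ∂μ, z ∈ Icc a b :=
  h.ae_mem_Ioo.mono fun _ hz => Ioo_subset_Icc_self hz

theorem integral_eq (h : IsValuationLaw μ f a b) (φ : ℝ → ℝ) :
    ∫ z, φ z ∂μ = ∫ z in Icc a b, f z * φ z := by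
  have h1 := integral_withDensity_eq_integral_toReal_smul (μ := volume.restrict (Icc a b))
    h.measurable_density.ennreal_ofReal (by simp) φ
  rw [← h.eq_withDensity] at h1
  rw [h1]
  refine setIntegral_congr_fun measurableSet_Icc fun z hz => ?_
  simp [ENNReal.toReal_ofReal (h.density_pos z hz).le]

theorem integrable_iff (h : IsValuationLaw μ f a b) (φ : ℝ → ℝ) :
    Integrable φ μ ↔ IntegrableOn (fun z => f z * φ z) (Icc a b) := by
  have h1 := integrable_withDensity_iff_integrable_smul' (μ := volume.restrict (Icc a b))
    (g := φ) h.measurable_density.ennreal_ofReal (by simp)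
  rw [← h.eq_withDensity] at h1
  rw [h1]
  refine integrable_congr ?_
  filter_upwards [ae_restrict_mem measurableSet_Icc] with z hz
  simp [ENNReal.toReal_ofReal (h.density_pos z hz).le]

theorem density_mul_virtualVal (h : IsValuationLaw μ f a b) {z : ℝ} (hz : z ∈ Icc a b) :
    f z * virtualVal μ f z = 1 - cdf μ z :=
  mul_div_cancel₀ _ (h.density_pos z hz).ne'

theorem virtualVal_nonneg (h : IsValuationLaw μ f a b) {z : ℝ} (hz : z ∈ Icc a b) :
    0 ≤ virtualVal μ f z :=
  div_nonneg (sub_nonneg.2 (cdf_le_one μ z)) (h.density_pos z hz).le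

variable [IsProbabilityMeasure μ]

theorem continuous_cdf (h : IsValuationLaw μ f a b) : Continuous (cdf μ) := by
  refine continuous_iff_continuousAt.2 fun z => ?_
  rw [(monotone_cdf μ).continuousAt_iff_leftLim_eq_rightLim, StieltjesFunction.rightLim_eq]
  have h1 := (cdf μ).measure_singleton z
  rw [measure_cdf, h.measure_singleton, eq_comm, ENNReal.ofReal_eq_zero] at h1
  exact le_antisymm ((monotone_cdf μ).leftLim_le le_rfl) (by linarith)

theorem cdf_left (h : IsValuationLaw μ f a b) : cdf μ a = 0 := by
  have : μ (Iic a) = 0 := by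
    have := h.ae_mem_Ioo
    rw [ae_iff] at this
    refine measure_mono_null (fun z hz => ?_) this
    exact fun hz' => absurd hz'.1 (not_lt.2 hz)
  rw [cdf_eq_real, measureReal_def, this, ENNReal.toReal_zero]

theorem cdf_right (h : IsValuationLaw μ f a b) : cdf μ b = 1 := by
  have : μ (Iic b) = 1 := by
    rw [prob_compl_eq_zero_iff measurableSet_Iic |>.symm]
    have := h.ae_mem_Ioo
    rw [ae_iff] at this
    refine measure_mono_null (fun z hz => ?_) this
    exact fun hz' => hz hz'.2.le
  rw [cdf_eq_real, measureReal_def, this, ENNReal.toReal_one]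

theorem strictMonoOn_cdf (h : IsValuationLaw μ f a b) : StrictMonoOn (cdf μ) (Icc a b) := by
  intro x hx y hy hxy
  refine lt_of_le_of_ne (monotone_cdf μ hxy.le) fun heq => ?_
  have h1 : μ (Ioc x y) = 0 := by
    have := (cdf μ).measure_Ioc x y
    rw [measure_cdf, heq, sub_self, ENNReal.ofReal_zero] at this
    exact this
  rw [h.eq_withDensity, withDensity_apply_eq_zero h.measurable_density.ennreal_ofReal] at h1
  have h2 : Ioc x y ⊆ {z | ENNReal.ofReal (f z) ≠ 0} ∩ Ioc x y := fun z hz =>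
    ⟨by simpa using h.density_pos z ⟨hx.1.trans hz.1.le, hz.2.trans hy.2⟩, hz⟩
  have h3 := measure_mono_null h2 h1
  have h4 : Ioc x y ⊆ Icc a b := fun z hz => ⟨hx.1.trans hz.1.le, hz.2.trans hy.2⟩
  rw [Measure.restrict_apply measurableSet_Ioc, inter_eq_self_of_subset_left h4, Real.volume_Ioc,
    ENNReal.ofReal_eq_zero] at h3
  linarith

theorem cdf_mem_Icc (μ : Measure ℝ) (z : ℝ) : cdf μ z ∈ Icc (0 : ℝ) 1 :=
  ⟨cdf_nonneg μ z, cdf_le_one μ z⟩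

theorem cdf_mem_Ioo (h : IsValuationLaw μ f a b) {z : ℝ} (hz : z ∈ Ioo a b) :
    cdf μ z ∈ Ioo (0 : ℝ) 1 :=
  ⟨h.cdf_left ▸ h.strictMonoOn_cdf ⟨le_rfl, h.lt.le⟩ (Ioo_subset_Icc_self hz) hz.1,
    h.cdf_right ▸ h.strictMonoOn_cdf (Ioo_subset_Icc_self hz) ⟨h.lt.le, le_rfl⟩ hz.2⟩

theorem exists_cdf_eq (h : IsValuationLaw μ f a b) {q : ℝ} (hq : q ∈ Icc (0 : ℝ) 1) :
    ∃ z ∈ Icc a b, cdf μ z = q := by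
  have := intermediate_value_Icc h.lt.le h.continuous_cdf.continuousOn
  rw [h.cdf_left, h.cdf_right] at this
  exact this hq

theorem cdfInv_mem (h : IsValuationLaw μ f a b) {q : ℝ} (hq : q ∈ Icc (0 : ℝ) 1) :
    cdfInv μ a b q ∈ Icc a b :=
  Function.invFunOn_mem (h.exists_cdf_eq hq)

theorem cdf_cdfInv (h : IsValuationLaw μ f a b) {q : ℝ} (hq : q ∈ Icc (0 : ℝ) 1) :
    cdf μ (cdfInv μ a b q) = q :=
  Function.invFunOn_eq (h.exists_cdf_eq hq)

theorem cdfInv_cdf (h : IsValuationLaw μ f a b) {z : ℝ} (hz : z ∈ Icc a b) :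
    cdfInv μ a b (cdf μ z) = z :=
  h.strictMonoOn_cdf.injOn (h.cdfInv_mem (cdf_mem_Icc μ z)) hz (h.cdf_cdfInv (cdf_mem_Icc μ z))

theorem monotoneOn_cdfInv (h : IsValuationLaw μ f a b) :
    MonotoneOn (cdfInv μ a b) (Icc 0 1) := by
  intro q hq r hr hqr
  rw [← h.strictMonoOn_cdf.le_iff_le (h.cdfInv_mem hq) (h.cdfInv_mem hr), h.cdf_cdfInv hq,
    h.cdf_cdfInv hr]
  exact hqr

/-- The distribution function maps the valuation law to the uniform law on `[0, 1]`. -/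
theorem map_cdf (h : IsValuationLaw μ f a b) :
    μ.map (cdf μ) = volume.restrict (Icc 0 1) := by
  have hm : Measurable (cdf μ) := h.continuous_cdf.measurable
  have : IsProbabilityMeasure (μ.map (cdf μ)) := Measure.isProbabilityMeasure_map hm.aemeasurable
  refine Measure.ext_of_Iic _ _ fun q => ?_
  rw [Measure.map_apply hm measurableSet_Iic, Measure.restrict_apply measurableSet_Iic]
  rcases lt_or_ge q 0 with hq0 | hq0
  · have e1 : cdf μ ⁻¹' Iic q = ∅ := by
      ext z; simpa using hq0.trans_le (cdf_nonneg μ z)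
    have e2 : Iic q ∩ Icc (0 : ℝ) 1 = ∅ := by
      ext z; simp only [mem_inter_iff, mem_Iic, mem_Icc, mem_empty_iff_false, iff_false]
      rintro ⟨h1, h2, -⟩; linarith
    rw [e1, e2]; simp
  rcases lt_or_ge 1 q with hq1 | hq1
  · have e1 : cdf μ ⁻¹' Iic q = univ := by
      ext z; simpa using (cdf_le_one μ z).trans hq1.le
    have e2 : Iic q ∩ Icc (0 : ℝ) 1 = Icc 0 1 :=
      inter_eq_self_of_subset_right fun z hz => hz.2.trans hq1.le
    rw [e1, e2]; simp
  obtain ⟨z, hz, hzq⟩ := h.exists_cdf_eq ⟨hq0, hq1⟩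
  have e1 : cdf μ ⁻¹' Iic q =ᵐ[μ] Iic z := by
    filter_upwards [h.ae_mem_Icc] with y hy
    have : (cdf μ y ≤ q) = (y ≤ z) := by
      rw [← hzq, h.strictMonoOn_cdf.le_iff_le hy hz]
    exact this
  have e2 : Iic q ∩ Icc (0 : ℝ) 1 = Icc 0 q := by
    ext y; simp only [mem_inter_iff, mem_Iic, mem_Icc]
    constructor
    · rintro ⟨h1, h2, -⟩; exact ⟨h2, h1⟩
    · rintro ⟨h1, h2⟩; exact ⟨h2, h1, h2.trans hq1⟩
  rw [measure_congr e1, e2, Real.volume_Icc, sub_zero, ← ofReal_cdf, hzq]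

/-- Integrating `φ ∘ F` above `c` is integrating `φ` over `[F c, 1]`. -/
theorem setIntegral_comp_cdf (h : IsValuationLaw μ f a b) {φ : ℝ → ℝ}
    (hφ : AEStronglyMeasurable φ (volume.restrict (Icc 0 1))) {c : ℝ} (hc : c ∈ Icc a b) :
    ∫ z in Ioi c, φ (cdf μ z) ∂μ = ∫ q in (cdf μ c)..1, φ q := by
  have hm : Measurable (cdf μ) := h.continuous_cdf.measurable
  have e1 : (Ioi c : Set ℝ) =ᵐ[μ] cdf μ ⁻¹' Ioi (cdf μ c) := by
    filter_upwards [h.ae_mem_Icc] with y hy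
    have : (c < y) = (cdf μ c < cdf μ y) := by rw [h.strictMonoOn_cdf.lt_iff_lt hc hy]
    exact this
  have e2 : Ioi (cdf μ c) ∩ Icc (0 : ℝ) 1 = Ioc (cdf μ c) 1 := by
    ext y; simp only [mem_inter_iff, mem_Ioi, mem_Icc, mem_Ioc]
    constructor
    · rintro ⟨h1, -, h3⟩; exact ⟨h1, h3⟩
    · rintro ⟨h1, h2⟩; exact ⟨h1, (cdf_nonneg μ c).trans h1.le, h2⟩
  rw [setIntegral_congr_set e1, ← setIntegral_map measurableSet_Ioi
    (by rw [h.map_cdf]; exact hφ) hm.aemeasurable, h.map_cdf,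
    Measure.restrict_restrict measurableSet_Ioi, e2,
    intervalIntegral.integral_of_le (cdf_le_one μ c)]

theorem integrable_comp_cdf_iff (h : IsValuationLaw μ f a b) {φ : ℝ → ℝ}
    (hφ : AEStronglyMeasurable φ (volume.restrict (Icc 0 1))) :
    Integrable (fun z => φ (cdf μ z)) μ ↔ IntegrableOn φ (Icc 0 1) := by
  rw [IntegrableOn, ← h.map_cdf, integrable_map_measure (by rw [h.map_cdf]; exact hφ)
    h.continuous_cdf.measurable.aemeasurable]
  rfl

/-! ### The virtual valuation and its ironing -/

theorem measurable_virtualVal (h : IsValuationLaw μ f a b) : Measurable (virtualVal μ f) :=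
  (measurable_const.sub h.continuous_cdf.measurable).div h.measurable_density

/-- The virtual valuation may be unbounded where `f` is small, but `f ϑ = 1 - F` is continuous on
`[a, b]`. -/
theorem integrable_virtualVal (h : IsValuationLaw μ f a b) : Integrable (virtualVal μ f) μ := by
  rw [h.integrable_iff]
  refine IntegrableOn.congr_fun (f := fun z => 1 - cdf μ z) ?_
    (fun z hz => (h.density_mul_virtualVal hz).symm) measurableSet_Icc
  exact (continuous_const.sub h.continuous_cdf).continuousOn.integrableOn_Icc

theorem aestronglyMeasurable_hFun (h : IsValuationLaw μ f a b) :
    AEStronglyMeasurable (hFun μ f a b) (volume.restrict (Icc 0 1)) :=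
  (h.measurable_virtualVal.comp_aemeasurable
    (aemeasurable_restrict_of_monotoneOn measurableSet_Icc h.monotoneOn_cdfInv)).aestronglyMeasurable

theorem hFun_cdf (h : IsValuationLaw μ f a b) {z : ℝ} (hz : z ∈ Icc a b) :
    hFun μ f a b (cdf μ z) = virtualVal μ f z := by
  rw [hFun, h.cdfInv_cdf hz]

theorem integrableOn_hFun (h : IsValuationLaw μ f a b) : IntegrableOn (hFun μ f a b) (Icc 0 1) := by
  rw [← h.integrable_comp_cdf_iff h.aestronglyMeasurable_hFun]
  refine h.integrable_virtualVal.congr ?_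
  filter_upwards [h.ae_mem_Icc] with z hz using (h.hFun_cdf hz).symm

theorem intervalIntegrable_hFun (h : IsValuationLaw μ f a b) {q r : ℝ} (hq : q ∈ Icc (0 : ℝ) 1)
    (hr : r ∈ Icc (0 : ℝ) 1) : IntervalIntegrable (hFun μ f a b) volume q r :=
  (h.integrableOn_hFun.mono_set (uIcc_subset_Icc hq hr)).intervalIntegrable

theorem continuousOn_HFun (h : IsValuationLaw μ f a b) :
    ContinuousOn (HFun μ f a b) (Icc 0 1) := by
  have := intervalIntegral.continuousOn_primitive_interval (μ := volume) (f := hFun μ f a b)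
    (a := 0) (b := 1) (by rw [uIcc_of_le zero_le_one]; exact h.integrableOn_hFun)
  rwa [uIcc_of_le zero_le_one] at this

theorem HFun_zero (μ : Measure ℝ) (f : ℝ → ℝ) (a b : ℝ) : HFun μ f a b 0 = 0 := by
  simp [HFun]

theorem HFun_nonneg (h : IsValuationLaw μ f a b) : ∀ q ∈ Icc (0 : ℝ) 1, 0 ≤ HFun μ f a b q :=
  fun _ hq => intervalIntegral.integral_nonneg hq.1 fun _ hr =>
    h.virtualVal_nonneg (h.cdfInv_mem ⟨hr.1, hr.2.trans hq.2⟩)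

theorem setIntegral_virtualVal (h : IsValuationLaw μ f a b) {c : ℝ} (hc : c ∈ Icc a b) :
    ∫ z in Ioi c, virtualVal μ f z ∂μ = HFun μ f a b 1 - HFun μ f a b (cdf μ c) := by
  have e : ∫ z in Ioi c, virtualVal μ f z ∂μ = ∫ z in Ioi c, hFun μ f a b (cdf μ z) ∂μ := by
    refine integral_congr_ae (ae_restrict_of_ae ?_)
    filter_upwards [h.ae_mem_Icc] with z hz using (h.hFun_cdf hz).symm
  rw [e, h.setIntegral_comp_cdf h.aestronglyMeasurable_hFun hc, HFun, HFun,
    intervalIntegral.integral_interval_sub_left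
      (h.intervalIntegrable_hFun ⟨le_rfl, zero_le_one⟩ ⟨zero_le_one, le_rfl⟩)
      (h.intervalIntegrable_hFun ⟨le_rfl, zero_le_one⟩ (cdf_mem_Icc μ c))]

theorem convexOn_GFun (h : IsValuationLaw μ f a b) : ConvexOn ℝ (Icc 0 1) (GFun μ f a b) :=
  convexOn_convexHullFun h.HFun_nonneg

theorem continuousOn_GFun (h : IsValuationLaw μ f a b) :
    ContinuousOn (GFun μ f a b) (Icc 0 1) :=
  continuousOn_convexHullFun h.continuousOn_HFun h.HFun_nonneg (HFun_zero μ f a b)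

theorem GFun_zero (h : IsValuationLaw μ f a b) : GFun μ f a b 0 = 0 :=
  convexHullFun_zero h.HFun_nonneg (HFun_zero μ f a b)

theorem GFun_one (h : IsValuationLaw μ f a b) : GFun μ f a b 1 = HFun μ f a b 1 :=
  convexHullFun_one h.continuousOn_HFun h.HFun_nonneg

theorem GFun_nonneg (h : IsValuationLaw μ f a b) {q : ℝ} (hq : q ∈ Icc (0 : ℝ) 1) :
    0 ≤ GFun μ f a b q :=
  convexHullFun_nonneg h.HFun_nonneg hq

theorem GFun_le_HFun (h : IsValuationLaw μ f a b) {q : ℝ} (hq : q ∈ Icc (0 : ℝ) 1) :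
    GFun μ f a b q ≤ HFun μ f a b q :=
  convexHullFun_le h.HFun_nonneg hq

/-- The right derivative of the convex hull `G`. -/
def _root_.MoneyBurning.rightDerivG (μ : Measure ℝ) (f : ℝ → ℝ) (a b q : ℝ) : ℝ :=
  derivWithin (GFun μ f a b) (Ioi q) q

/-- The ironed virtual valuation computed with right derivatives only. -/
def _root_.MoneyBurning.rightIronedVal (μ : Measure ℝ) (f : ℝ → ℝ) (a b z : ℝ) : ℝ :=
  rightDerivG μ f a b (cdf μ z)

theorem measurable_rightDerivG (μ : Measure ℝ) (f : ℝ → ℝ) (a b : ℝ) :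
    Measurable (rightDerivG μ f a b) :=
  measurable_derivWithin_Ioi _

theorem measurable_rightIronedVal (h : IsValuationLaw μ f a b) :
    Measurable (rightIronedVal μ f a b) :=
  (measurable_rightDerivG μ f a b).comp h.continuous_cdf.measurable

/-- The endpoints of `[a, b]` are null, so the left-derivative convention at quantile `1` never
affects an expectation and right derivatives suffice. -/
theorem ironedVal_eq (h : IsValuationLaw μ f a b) {z : ℝ} (hz : z ∈ Ioo a b) :
    ironedVal μ f a b z = rightIronedVal μ f a b z :=
  if_pos (h.cdf_mem_Ioo hz).2

theorem hasDerivWithinAt_GFun (h : IsValuationLaw μ f a b) {q : ℝ} (hq : q ∈ Ioo (0 : ℝ) 1) :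
    HasDerivWithinAt (GFun μ f a b) (rightDerivG μ f a b q) (Ioi q) q :=
  h.convexOn_GFun.hasDerivWithinAt_rightDeriv_of_mem_interior (by rwa [interior_Icc])

theorem monotoneOn_rightDerivG (h : IsValuationLaw μ f a b) :
    MonotoneOn (rightDerivG μ f a b) (Ioo 0 1) := by
  have := h.convexOn_GFun.monotoneOn_rightDeriv
  rwa [interior_Icc] at this

/-- Since `G 0 = 0 ≤ G`, the slope from `0` to `q` is nonnegative, and convexity passes this on to
all later slopes. -/
theorem rightDerivG_nonneg (h : IsValuationLaw μ f a b) {q : ℝ} (hq : q ∈ Ioo (0 : ℝ) 1) :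
    0 ≤ rightDerivG μ f a b q := by
  have hG : ∀ r ∈ Ioo q 1, GFun μ f a b q ≤ GFun μ f a b r := by
    intro r hr
    have h1 := h.convexOn_GFun.slope_mono_adjacent ⟨le_rfl, zero_le_one⟩
      ⟨hq.1.le.trans hr.1.le, hr.2.le⟩ hq.1 hr.1
    rw [h.GFun_zero, sub_zero, sub_zero] at h1
    have h2 := (div_nonneg (h.GFun_nonneg (Ioo_subset_Icc_self hq)) hq.1.le).trans h1
    have h3 : 0 < r - q := sub_pos.2 hr.1
    have h4 := mul_nonneg h2 h3.le
    rw [div_mul_cancel₀ _ h3.ne'] at h4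
    linarith
  have hd := (hasDerivWithinAt_iff_tendsto_slope' (by simp)).1 (h.hasDerivWithinAt_GFun hq)
  refine ge_of_tendsto hd ?_
  filter_upwards [Ioo_mem_nhdsGT hq.2] with r hr
  rw [slope_def_field]
  exact div_nonneg (sub_nonneg.2 (hG r hr)) (sub_nonneg.2 hr.1.le)

/-- A nonnegative right derivative of a continuous function is integrable, so no bound on the slope
of `G` near `1` is needed. -/
theorem integrableOn_rightDerivG (h : IsValuationLaw μ f a b) :
    IntegrableOn (rightDerivG μ f a b) (Icc 0 1) := by
  have := intervalIntegral.integrableOn_deriv_right_of_nonneg h.continuousOn_GFun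
    (fun q hq => h.hasDerivWithinAt_GFun hq) (fun q hq => h.rightDerivG_nonneg hq)
  rwa [integrableOn_Icc_iff_integrableOn_Ioc]

theorem integrable_rightIronedVal (h : IsValuationLaw μ f a b) :
    Integrable (rightIronedVal μ f a b) μ :=
  (h.integrable_comp_cdf_iff (measurable_rightDerivG μ f a b).aestronglyMeasurable).2
    h.integrableOn_rightDerivG

theorem setIntegral_rightIronedVal (h : IsValuationLaw μ f a b) {c : ℝ} (hc : c ∈ Icc a b) :
    ∫ z in Ioi c, rightIronedVal μ f a b z ∂μ = GFun μ f a b 1 - GFun μ f a b (cdf μ c) := by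
  refine (h.setIntegral_comp_cdf (measurable_rightDerivG μ f a b).aestronglyMeasurable hc).trans ?_
  have hsub : uIcc (cdf μ c) 1 ⊆ Icc 0 1 :=
    uIcc_subset_Icc (cdf_mem_Icc μ c) ⟨zero_le_one, le_rfl⟩
  refine intervalIntegral.integral_eq_sub_of_hasDeriv_right (h.continuousOn_GFun.mono hsub)
    (fun q hq => h.hasDerivWithinAt_GFun ?_)
    (h.integrableOn_rightDerivG.mono_set hsub).intervalIntegrable
  rw [min_eq_left (cdf_le_one μ c), max_eq_right (cdf_le_one μ c)] at hq
  exact ⟨(cdf_nonneg μ c).trans_lt hq.1, hq.2⟩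

theorem rightIronedVal_nonneg (h : IsValuationLaw μ f a b) {z : ℝ} (hz : z ∈ Ioo a b) :
    0 ≤ rightIronedVal μ f a b z :=
  h.rightDerivG_nonneg (h.cdf_mem_Ioo hz)

theorem monotoneOn_rightIronedVal (h : IsValuationLaw μ f a b) :
    MonotoneOn (rightIronedVal μ f a b) (Ioo a b) := fun _ hx _ hy hxy =>
  h.monotoneOn_rightDerivG (h.cdf_mem_Ioo hx) (h.cdf_mem_Ioo hy) (monotone_cdf μ hxy)

/-- The gap `H - G` at the quantile of `z`. -/
def _root_.MoneyBurning.ironingGap (μ : Measure ℝ) (f : ℝ → ℝ) (a b z : ℝ) : ℝ :=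
  HFun μ f a b (cdf μ z) - GFun μ f a b (cdf μ z)

theorem ironingGap_nonneg (h : IsValuationLaw μ f a b) (z : ℝ) : 0 ≤ ironingGap μ f a b z :=
  sub_nonneg.2 (h.GFun_le_HFun (cdf_mem_Icc μ z))

theorem ironingGap_left (h : IsValuationLaw μ f a b) : ironingGap μ f a b a = 0 := by
  rw [ironingGap, h.cdf_left, h.GFun_zero, HFun_zero, sub_zero]

theorem ironingGap_right (h : IsValuationLaw μ f a b) : ironingGap μ f a b b = 0 := by
  rw [ironingGap, h.cdf_right, h.GFun_one, sub_self]

theorem continuous_ironingGap (h : IsValuationLaw μ f a b) : Continuous (ironingGap μ f a b) :=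
  (h.continuousOn_HFun.comp_continuous h.continuous_cdf (cdf_mem_Icc μ)).sub
    (h.continuousOn_GFun.comp_continuous h.continuous_cdf (cdf_mem_Icc μ))

/-- This is the correction for the step function at `c`; the boundary terms cancel because `G 1 = H
1`. -/
theorem setIntegral_virtualVal_sub (h : IsValuationLaw μ f a b) {c : ℝ} (hc : c ∈ Icc a b) :
    ∫ z in Ioi c, (virtualVal μ f z - rightIronedVal μ f a b z) ∂μ = -ironingGap μ f a b c := by
  rw [integral_sub h.integrable_virtualVal.integrableOn h.integrable_rightIronedVal.integrableOn,
    h.setIntegral_virtualVal hc, h.setIntegral_rightIronedVal hc, h.GFun_one, ironingGap]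
  ring

theorem mem_Ioo_of_ironingGap_pos (h : IsValuationLaw μ f a b) {z : ℝ} (hz : z ∈ Icc a b)
    (hgap : 0 < ironingGap μ f a b z) : z ∈ Ioo a b := by
  refine ⟨lt_of_le_of_ne hz.1 ?_, lt_of_le_of_ne hz.2 ?_⟩
  · rintro rfl; exact hgap.ne' h.ironingGap_left
  · rintro rfl; exact hgap.ne' h.ironingGap_right

/-- The ironed virtual valuation is locally constant where the ironing gap is positive. -/
theorem eventually_rightIronedVal_eq (h : IsValuationLaw μ f a b) {z : ℝ} (hz : z ∈ Ioo a b)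
    (hgap : 0 < ironingGap μ f a b z) :
    ∀ᶠ y in 𝓝 z, rightIronedVal μ f a b y = rightIronedVal μ f a b z := by
  obtain ⟨k, c, δ, hδ, haff⟩ := exists_convexHullFun_eq_affine h.continuousOn_HFun h.HFun_nonneg
    (HFun_zero μ f a b) (h.cdf_mem_Ioo hz) (sub_pos.1 hgap)
  -- Near `F(z)` the hull is affine with slope `k`, which is then its right derivative.
  have key : ∀ q ∈ Ioo (cdf μ z - δ) (cdf μ z + δ), rightDerivG μ f a b q = k := by
    intro q hq
    have h1 : HasDerivAt (fun r : ℝ => k * r + c) k q := by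
      simpa using ((hasDerivAt_id q).const_mul k).add_const c
    have h2 : HasDerivAt (GFun μ f a b) k q := h1.congr_of_eventuallyEq <| by
      filter_upwards [Ioo_mem_nhds hq.1 hq.2] with r hr using (haff r hr).2
    exact h2.hasDerivWithinAt.derivWithin (uniqueDiffWithinAt_Ioi q)
  have hmem : Ioo (cdf μ z - δ) (cdf μ z + δ) ∈ 𝓝 (cdf μ z) :=
    Ioo_mem_nhds (by linarith) (by linarith)
  filter_upwards [h.continuous_cdf.continuousAt hmem] with y hy
  rw [rightIronedVal, rightIronedVal, key _ hy, key _ (mem_of_mem_nhds hmem)]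

end IsValuationLaw

/-! ### Ironing a monotone allocation rule -/

/-- The point of `[a, b]` at which the monotone function `x` passes the level `s`. -/
def threshold (a b : ℝ) (x : ℝ → ℝ) (s : ℝ) : ℝ :=
  sInf ({z | z ∈ Icc a b ∧ s < x z} ∪ {b})

section Threshold

variable {a b : ℝ} {x : ℝ → ℝ}

theorem bddBelow_threshold (hab : a ≤ b) (s : ℝ) :
    BddBelow ({z | z ∈ Icc a b ∧ s < x z} ∪ {b}) := by
  refine ⟨a, ?_⟩
  rintro z (hz | rfl)
  exacts [hz.1.1, hab]

theorem threshold_mem (hab : a ≤ b) (s : ℝ) : threshold a b x s ∈ Icc a b := by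
  refine ⟨le_csInf ⟨b, Or.inr rfl⟩ ?_, csInf_le (bddBelow_threshold hab s) (Or.inr rfl)⟩
  rintro z (hz | rfl)
  exacts [hz.1.1, hab]

theorem lt_of_threshold_lt (hx : MonotoneOn x (Icc a b)) {s z : ℝ} (hz : z ∈ Icc a b)
    (hlt : threshold a b x s < z) : s < x z := by
  obtain ⟨y, hy | rfl, hyz⟩ := exists_lt_of_csInf_lt ⟨b, Or.inr rfl⟩ hlt
  · exact hy.2.trans_le (hx hy.1 hz hyz.le)
  · exact absurd hz.2 (not_le.2 hyz)

theorem threshold_le (hab : a ≤ b) {s z : ℝ} (hz : z ∈ Icc a b) (hlt : s < x z) :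
    threshold a b x s ≤ z :=
  csInf_le (bddBelow_threshold hab s) (Or.inl ⟨hz, hlt⟩)

end Threshold

/-! ### Layer-cake decomposition of the ironing correction -/

namespace IsValuationLaw

variable {μ : Measure ℝ} {f : ℝ → ℝ} {a b : ℝ} [IsProbabilityMeasure μ] {x : ℝ → ℝ}

theorem integrable_level (h : IsValuationLaw μ f a b) (hx : Measurable x) :
    Integrable ({p : ℝ × ℝ | p.2 < x p.1}.indicator
      fun p => virtualVal μ f p.1 - rightIronedVal μ f a b p.1)
      (μ.prod (volume.restrict (Ico 0 1))) :=
  ((h.integrable_virtualVal.sub h.integrable_rightIronedVal).comp_fst _).indicator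
    (measurableSet_lt measurable_snd (hx.comp measurable_fst))

/-- By monotonicity the superlevel set `{x > s}` is, up to the null point at the threshold, the
half-line above it. If the level is never passed, the threshold is `b`, where the gap is zero. -/
theorem integral_level (h : IsValuationLaw μ f a b) (hmono : MonotoneOn x (Icc a b)) (s : ℝ) :
    ∫ z, {p : ℝ × ℝ | p.2 < x p.1}.indicator
      (fun p => virtualVal μ f p.1 - rightIronedVal μ f a b p.1) (z, s) ∂μ =
      -ironingGap μ f a b (threshold a b x s) := by
  rw [← h.setIntegral_virtualVal_sub (threshold_mem h.lt.le s), ← integral_indicator measurableSet_Ioi]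
  refine integral_congr_ae ?_
  have hne : ∀ᵐ z ∂μ, z ≠ threshold a b x s := by simp [ae_iff, h.measure_singleton]
  filter_upwards [h.ae_mem_Icc, hne] with z hz hzne
  have hiff : (z, s) ∈ {p : ℝ × ℝ | p.2 < x p.1} ↔ z ∈ Ioi (threshold a b x s) :=
    ⟨fun hlt => lt_of_le_of_ne (threshold_le h.lt.le hz hlt) hzne.symm,
      fun hlt => lt_of_threshold_lt hmono hz hlt⟩
  by_cases hmem : z ∈ Ioi (threshold a b x s)
  · rw [indicator_of_mem hmem, indicator_of_mem (hiff.2 hmem)]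
  · rw [indicator_of_notMem hmem, indicator_of_notMem (fun hc => hmem (hiff.1 hc))]

theorem integrableOn_ironingGap_threshold (h : IsValuationLaw μ f a b) (hx : Measurable x)
    (hmono : MonotoneOn x (Icc a b)) :
    IntegrableOn (fun s => ironingGap μ f a b (threshold a b x s)) (Ico 0 1) := by
  have := (h.integrable_level hx).integral_prod_right
  simp_rw [h.integral_level hmono] at this
  simpa [IntegrableOn] using this.neg

/-- Replacing the virtual valuation by the ironed one changes the objective by an average of
ironing gaps. -/
theorem integral_virtualVal_sub_mul (h : IsValuationLaw μ f a b) (hx : Measurable x)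
    (hmono : MonotoneOn x (Icc a b)) (h01 : ∀ z, x z ∈ Icc (0 : ℝ) 1) :
    ∫ z, (virtualVal μ f z - rightIronedVal μ f a b z) * x z ∂μ =
      -∫ s in Ico (0 : ℝ) 1, ironingGap μ f a b (threshold a b x s) := by
  -- Layer cake: `x z` is the length of `{s ∈ [0, 1) | s < x z}`; the order of integration in `s`
  -- and `z` is exchanged.
  have hswap := integral_integral_swap
    (f := fun z s => {p : ℝ × ℝ | p.2 < x p.1}.indicator
      (fun p => virtualVal μ f p.1 - rightIronedVal μ f a b p.1) (z, s)) (h.integrable_level hx)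
  simp_rw [h.integral_level hmono] at hswap
  rw [← integral_neg, ← hswap]
  refine integral_congr_ae (Eventually.of_forall fun z => ?_)
  have e : (fun s => {p : ℝ × ℝ | p.2 < x p.1}.indicator
      (fun p => virtualVal μ f p.1 - rightIronedVal μ f a b p.1) (z, s)) =
      (Iio (x z)).indicator fun _ => virtualVal μ f z - rightIronedVal μ f a b z := by
    ext s
    simp only [indicator, mem_ofPred_eq, mem_Iio]
  have e2 : Iio (x z) ∩ Ico 0 1 = Ico 0 (x z) := by
    ext s; simp only [mem_inter_iff, mem_Iio, mem_Ico]
    constructor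
    · rintro ⟨h1, h2, -⟩; exact ⟨h2, h1⟩
    · rintro ⟨h1, h2⟩; exact ⟨h2, h1, h2.trans_le (h01 z).2⟩
  simp only [e]
  rw [integral_indicator_const _ measurableSet_Iio, measureReal_restrict_apply measurableSet_Iio,
    e2, Real.volume_real_Ico_of_le (h01 z).1, smul_eq_mul, sub_zero, mul_comm]

theorem integral_virtualVal_sub_mul_nonpos (h : IsValuationLaw μ f a b) (hx : Measurable x)
    (hmono : MonotoneOn x (Icc a b)) (h01 : ∀ z, x z ∈ Icc (0 : ℝ) 1) :
    ∫ z, (virtualVal μ f z - rightIronedVal μ f a b z) * x z ∂μ ≤ 0 := by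
  rw [h.integral_virtualVal_sub_mul hx hmono h01]
  exact neg_nonpos.2 (integral_nonneg fun s => h.ironingGap_nonneg _)

/-- No threshold can have a positive gap: `x` would be constant around it, so points just below it
would already exceed the level. -/
theorem integral_virtualVal_sub_mul_eq_zero (h : IsValuationLaw μ f a b) (hx : Measurable x)
    (hmono : MonotoneOn x (Icc a b)) (h01 : ∀ z, x z ∈ Icc (0 : ℝ) 1)
    (hloc : ∀ z ∈ Icc a b, 0 < ironingGap μ f a b z → ∀ᶠ y in 𝓝 z, x y = x z) :
    ∫ z, (virtualVal μ f z - rightIronedVal μ f a b z) * x z ∂μ = 0 := by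
  rw [h.integral_virtualVal_sub_mul hx hmono h01, neg_eq_zero]
  refine integral_eq_zero_of_ae (Eventually.of_forall fun s => ?_)
  by_contra hne
  set c := threshold a b x s with hc
  have hgap : 0 < ironingGap μ f a b c := lt_of_le_of_ne (h.ironingGap_nonneg c) (Ne.symm hne)
  have hcm : c ∈ Icc a b := threshold_mem h.lt.le s
  have hco := h.mem_Ioo_of_ironingGap_pos hcm hgap
  have hev := (hloc c hcm hgap).and (Ioo_mem_nhds hco.1 hco.2)
  obtain ⟨y, ⟨hy1, hy2⟩, hyc⟩ :=
    ((hev.filter_mono nhdsWithin_le_nhds).and (self_mem_nhdsWithin (s := Iio c))).exists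
  obtain ⟨y', ⟨hy1', hy2'⟩, hyc'⟩ :=
    ((hev.filter_mono nhdsWithin_le_nhds).and (self_mem_nhdsWithin (s := Ioi c))).exists
  have hs := lt_of_threshold_lt hmono (Ioo_subset_Icc_self hy2') hyc'
  rw [hy1', ← hy1] at hs
  exact absurd (threshold_le h.lt.le (Ioo_subset_Icc_self hy2) hs) (not_le.2 hyc)

theorem eventually_eq_of_integral_virtualVal_sub_mul_eq_zero (h : IsValuationLaw μ f a b)
    (hx : Measurable x) (hmono : MonotoneOn x (Icc a b)) (h01 : ∀ z, x z ∈ Icc (0 : ℝ) 1)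
    (hzero : ∫ z, (virtualVal μ f z - rightIronedVal μ f a b z) * x z ∂μ = 0) {z : ℝ}
    (hz : z ∈ Icc a b) (hgap : 0 < ironingGap μ f a b z) : ∀ᶠ y in 𝓝 z, x y = x z := by
  rw [h.integral_virtualVal_sub_mul hx hmono h01, neg_eq_zero,
    integral_eq_zero_iff_of_nonneg (fun s => h.ironingGap_nonneg _)
      (h.integrableOn_ironingGap_threshold hx hmono)] at hzero
  have hzo := h.mem_Ioo_of_ironingGap_pos hz hgap
  have hev : ∀ᶠ y in 𝓝 z, 0 < ironingGap μ f a b y ∧ y ∈ Ioo a b :=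
    (h.continuous_ironingGap.continuousAt.eventually (lt_mem_nhds hgap)).and
      (Ioo_mem_nhds hzo.1 hzo.2)
  obtain ⟨ε, hε, hball⟩ := Metric.eventually_nhds_iff.1 hev
  have hin : ∀ y ∈ Ioo (z - ε) (z + ε), 0 < ironingGap μ f a b y ∧ y ∈ Ioo a b := fun y hy =>
    hball (by rw [Real.dist_eq, abs_lt]; constructor <;> linarith [hy.1, hy.2])
  have key : ∀ y₁ ∈ Ioo (z - ε) (z + ε), ∀ y₂ ∈ Ioo (z - ε) (z + ε), y₁ ≤ y₂ → x y₁ = x y₂ := by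
    intro y₁ h₁ y₂ h₂ h₁₂
    have hm₁ := Ioo_subset_Icc_self (hin y₁ h₁).2
    have hm₂ := Ioo_subset_Icc_self (hin y₂ h₂).2
    refine le_antisymm (hmono hm₁ hm₂ h₁₂) (not_lt.1 fun hlt => ?_)
    have hae := (ae_restrict_iff' measurableSet_Ico).1 hzero
    rw [ae_iff] at hae
    -- Every level strictly between `x y₁` and `x y₂` has its threshold in `[y₁, y₂]`, where the gap
    -- is positive; almost no level may do so.
    have hnull : volume (Ioo (x y₁) (x y₂)) = 0 := by
      refine measure_mono_null (fun s hs => ?_) hae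
      have hs01 : s ∈ Ico (0 : ℝ) 1 := ⟨(h01 y₁).1.trans hs.1.le, hs.2.trans_le (h01 y₂).2⟩
      have hle := threshold_le h.lt.le hm₂ hs.2
      have hge : y₁ ≤ threshold a b x s := not_lt.1 fun hc =>
        absurd (lt_of_threshold_lt hmono hm₁ hc) (not_lt.2 hs.1.le)
      exact fun hcon => (hin _ ⟨h₁.1.trans_le hge, hle.trans_lt h₂.2⟩).1.ne' (hcon hs01)
    rw [Real.volume_Ioo, ENNReal.ofReal_eq_zero] at hnull
    linarith
  have hzm : z ∈ Ioo (z - ε) (z + ε) := ⟨by linarith, by linarith⟩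
  filter_upwards [Ioo_mem_nhds hzm.1 hzm.2] with y hy
  rcases le_total y z with hyz | hyz
  · exact key y hy z hzm hyz
  · exact (key z hzm y hy hyz).symm

end IsValuationLaw

/-! ### Envelope formula -/

/-- A function with subgradient `x` at every point is the primitive of `x`. -/
theorem eq_add_integral_of_subgradient {a b : ℝ} {u x : ℝ → ℝ}
    (hsub : ∀ z ∈ Icc a b, ∀ z' ∈ Icc a b, u z + (z' - z) * x z ≤ u z')
    (h01 : ∀ z, x z ∈ Icc (0 : ℝ) 1) (hmono : MonotoneOn x (Icc a b)) {z : ℝ}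
    (hz : z ∈ Icc a b) : u z = u a + ∫ t in a..z, x t := by
  have hsubs : Icc a z ⊆ Icc a b := Icc_subset_Icc_right hz.2
  have hab : a ≤ b := hz.1.trans hz.2
  -- The Lipschitz constant is `1` because the subgradients lie in `[0, 1]`; only the resulting
  -- continuity is used.
  have hlip : LipschitzOnWith 1 u (Icc a b) := by
    refine LipschitzOnWith.of_le_add_mul 1 fun y hy y' hy' => ?_
    have h1 := hsub y hy y' hy'
    have h2 : (y - y') * x y ≤ |y - y'| := by
      calc (y - y') * x y ≤ |y - y'| * x y :=
            mul_le_mul_of_nonneg_right (le_abs_self _) (h01 y).1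
        _ ≤ |y - y'| * 1 := mul_le_mul_of_nonneg_left (h01 y).2 (abs_nonneg _)
        _ = _ := mul_one _
    rw [Real.dist_eq, NNReal.coe_one]
    linarith
  have hcont : ContinuousOn u (uIcc a z) := by
    rw [uIcc_of_le hz.1]; exact hlip.continuousOn.mono hsubs
  have hint : IntervalIntegrable x volume a z := by
    refine MonotoneOn.intervalIntegrable ?_
    rw [uIcc_of_le hz.1]; exact hmono.mono hsubs
  -- The subgradient inequalities at `y` and `y'` bound the error of the slope by `|x y' - x y|`, so
  -- `u' = x` wherever `x` is continuous. A monotone `x` has only countably many discontinuities.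
  have hderiv : ∀ y ∈ Ioo (min a z) (max a z) \
      {y | y ∈ Icc a b ∧ ¬ContinuousWithinAt x (Icc a b) y}, HasDerivAt u (x y) y := by
    rintro y ⟨hy, hyc⟩
    rw [min_eq_left hz.1, max_eq_right hz.1] at hy
    have hym : y ∈ Icc a b := hsubs (Ioo_subset_Icc_self hy)
    have hnhds : Icc a b ∈ 𝓝 y := Icc_mem_nhds hy.1 (hy.2.trans_le hz.2)
    have hxc : ContinuousAt x y := by
      by_contra hcon
      exact hyc ⟨hym, fun hw => hcon (hw.continuousAt hnhds)⟩
    rw [hasDerivAt_iff_tendsto_slope]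
    have hdiff : Tendsto (fun y' => |x y' - x y|) (𝓝[≠] y) (𝓝 0) := by
      have : Tendsto (fun y' => |x y' - x y|) (𝓝 y) (𝓝 |x y - x y|) :=
        (hxc.tendsto.sub tendsto_const_nhds).abs
      rw [sub_self, abs_zero] at this
      exact this.mono_left nhdsWithin_le_nhds
    rw [tendsto_iff_norm_sub_tendsto_zero]
    refine squeeze_zero' (Eventually.of_forall fun _ => norm_nonneg _) ?_ hdiff
    filter_upwards [nhdsWithin_le_nhds hnhds, self_mem_nhdsWithin] with y' hy' hne
    have h1 := hsub y hym y' hy'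
    have h2 := hsub y' hy' y hym
    have hne' : y' - y ≠ 0 := sub_ne_zero.2 hne
    have habs : 0 < |y' - y| := abs_pos.2 hne'
    have e : slope u y y' - x y = (u y' - u y - (y' - y) * x y) / (y' - y) := by
      rw [slope_def_field]; field_simp
    rw [e, Real.norm_eq_abs, abs_div, div_le_iff₀ habs, ← abs_mul,
      abs_of_nonneg (by linarith : 0 ≤ u y' - u y - (y' - y) * x y)]
    refine le_trans ?_ (le_abs_self _)
    nlinarith
  have := integral_eq_of_hasDerivAt_off_countable u x
    hmono.countable_not_continuousWithinAt hcont hderiv hint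
  linarith

/-! ### Overwriting one coordinate -/

/-- Checked on boxes: the new coordinate contributes `μ (s i)` and the discarded one has total mass
`1`. -/
theorem measurePreserving_update {n : ℕ} (μ : Measure ℝ) [IsProbabilityMeasure μ] (i : Fin n) :
    MeasurePreserving (fun p : ℝ × (Fin n → ℝ) => Function.update p.2 i p.1)
      (μ.prod (Measure.pi fun _ => μ)) (Measure.pi fun _ => μ) := by
  have hm : Measurable fun p : ℝ × (Fin n → ℝ) => Function.update p.2 i p.1 := by
    rw [measurable_pi_iff]
    intro j
    by_cases hj : j = i
    · subst hj; simpa using measurable_fst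
    · simp only [Function.update_of_ne hj]
      fun_prop
  refine ⟨hm, (Measure.pi_eq fun s hs => ?_).symm⟩
  rw [Measure.map_apply hm (MeasurableSet.univ_pi hs)]
  have e : (fun p : ℝ × (Fin n → ℝ) => Function.update p.2 i p.1) ⁻¹' univ.pi s =
      s i ×ˢ univ.pi (Function.update s i univ) := by
    ext p
    simp only [mem_preimage, Set.mem_pi, mem_univ, true_implies, mem_prod]
    constructor
    · intro hp
      refine ⟨by simpa using hp i, fun j => ?_⟩
      by_cases hj : j = i
      · subst hj; simp
      · simpa [Function.update_of_ne hj] using hp j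
    · rintro ⟨h1, h2⟩ j
      by_cases hj : j = i
      · subst hj; simpa using h1
      · simpa [Function.update_of_ne hj] using h2 j
  rw [e, Measure.prod_prod, Measure.pi_pi, ← Finset.mul_prod_erase _ _ (Finset.mem_univ i),
    ← Finset.mul_prod_erase Finset.univ (fun j => μ (s j)) (Finset.mem_univ i)]
  simp only [Function.update_self, measure_univ, one_mul]
  congr 1
  refine Finset.prod_congr rfl fun j hj => ?_
  rw [Function.update_of_ne (Finset.ne_of_mem_erase hj)]

namespace Mechanism

variable {n : ℕ} {Ω : Type*} [MeasurableSpace Ω] {μ : Measure ℝ} {P : Measure Ω}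

instance [IsProbabilityMeasure μ] [IsProbabilityMeasure P] :
    IsProbabilityMeasure (jointLaw n μ P) := by
  unfold jointLaw; infer_instance

/-- Redrawing the valuation of one agent does not change the joint law. -/
theorem measurePreserving_update_jointLaw [IsProbabilityMeasure μ] [IsProbabilityMeasure P]
    (i : Fin n) :
    MeasurePreserving (fun p : ℝ × ((Fin n → ℝ) × Ω) => (Function.update p.2.1 i p.1, p.2.2))
      (μ.prod (jointLaw n μ P)) (jointLaw n μ P) :=
  ((measurePreserving_update μ i).prod (MeasurePreserving.id P)).comp
    (measurePreserving_prodAssoc μ (Measure.pi fun _ : Fin n => μ) P).symm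

theorem measurePreserving_eval_jointLaw [IsProbabilityMeasure μ] [IsProbabilityMeasure P]
    (i : Fin n) : MeasurePreserving (fun q : (Fin n → ℝ) × Ω => q.1 i) (jointLaw n μ P) μ :=
  (measurePreserving_eval (fun _ : Fin n => μ) i).comp measurePreserving_fst

theorem ae_jointLaw_of_ae [IsProbabilityMeasure μ] [IsProbabilityMeasure P] {p : ℝ → Prop}
    (hp : ∀ᵐ z ∂μ, p z) : ∀ᵐ q ∂jointLaw n μ P, ∀ i, p (q.1 i) :=
  ae_all_iff.2 fun i => (measurePreserving_eval_jointLaw i).quasiMeasurePreserving.ae hp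

/-- Redrawing coordinate `i` followed by Fubini; this links ex ante expectations to interim
quantities. -/
theorem integral_jointLaw_eq [IsProbabilityMeasure μ] [IsProbabilityMeasure P]
    (i : Fin n) {K : (Fin n → ℝ) × Ω → ℝ} (hK : Integrable K (jointLaw n μ P)) :
    ∫ q, K q ∂jointLaw n μ P =
      ∫ z, ∫ q, K (Function.update q.1 i z, q.2) ∂jointLaw n μ P ∂μ := by
  have hmp := measurePreserving_update_jointLaw (μ := μ) (P := P) i
  have h1 := (hmp.integrable_comp hK.aestronglyMeasurable).2 hK
  rw [← hmp.map_eq, integral_map hmp.measurable.aemeasurable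
    (by rw [hmp.map_eq]; exact hK.aestronglyMeasurable)]
  rw [hmp.map_eq]
  exact integral_prod _ h1

theorem measurable_interim [IsProbabilityMeasure μ] [IsProbabilityMeasure P]
    (i : Fin n) {K : (Fin n → ℝ) × Ω → ℝ} (hK : Measurable K) :
    Measurable fun z => ∫ q, K (Function.update q.1 i z, q.2) ∂jointLaw n μ P := by
  have hmp := measurePreserving_update_jointLaw (μ := μ) (P := P) i
  exact ((hK.comp hmp.measurable).stronglyMeasurable.integral_prod_right').measurable

end Mechanism

/-! ### Residual surplus as expected virtual surplus -/

/-- The expectation of a primitive of `x` is the expected virtual valuation weighted by `x`. -/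
theorem IsValuationLaw.integral_primitive {μ : Measure ℝ} {f : ℝ → ℝ} {a b : ℝ}
    [IsProbabilityMeasure μ] (h : IsValuationLaw μ f a b) {x : ℝ → ℝ} (hx : Measurable x)
    (h01 : ∀ z, x z ∈ Icc (0 : ℝ) 1) :
    ∫ z, (∫ t in a..z, x t) ∂μ = ∫ z, virtualVal μ f z * x z ∂μ := by
  have hS : MeasurableSet {p : ℝ × ℝ | p.2 ≤ p.1} := measurableSet_le measurable_snd measurable_fst
  have hint : Integrable ({p : ℝ × ℝ | p.2 ≤ p.1}.indicator fun p => x p.2)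
      (μ.prod (volume.restrict (Icc a b))) := by
    refine Integrable.indicator ?_ hS
    refine Integrable.of_bound (hx.comp measurable_snd).aestronglyMeasurable 1 ?_
    refine Eventually.of_forall fun p => ?_
    rw [Real.norm_eq_abs, abs_of_nonneg (h01 p.2).1]
    exact (h01 p.2).2
  -- Fubini on `{t ≤ z}`: the weight of `x t` becomes the probability `1 - F(t) = f(t) ϑ(t)` of a
  -- valuation above `t`.
  have hswap := integral_integral_swap
    (f := fun z t => {p : ℝ × ℝ | p.2 ≤ p.1}.indicator (fun p => x p.2) (z, t)) hint
  have hl : ∫ z, (∫ t in a..z, x t) ∂μ = ∫ z, (∫ t in Icc a b,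
      {p : ℝ × ℝ | p.2 ≤ p.1}.indicator (fun p => x p.2) (z, t)) ∂μ := by
    refine integral_congr_ae ?_
    filter_upwards [h.ae_mem_Icc] with z hz
    have e : (fun t => {p : ℝ × ℝ | p.2 ≤ p.1}.indicator (fun p => x p.2) (z, t)) =
        (Iic z).indicator x := by
      ext t; simp only [indicator, mem_ofPred_eq, mem_Iic]
    have e2 : Iic z ∩ Icc a b = Icc a z := by
      ext t; simp only [mem_inter_iff, mem_Iic, mem_Icc]
      constructor
      · rintro ⟨h1, h2, -⟩; exact ⟨h2, h1⟩
      · rintro ⟨h1, h2⟩; exact ⟨h2, h1, h2.trans hz.2⟩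
    rw [e, integral_indicator measurableSet_Iic, Measure.restrict_restrict measurableSet_Iic, e2,
      integral_Icc_eq_integral_Ioc, intervalIntegral.integral_of_le hz.1]
  rw [hl, hswap, h.integral_eq]
  refine setIntegral_congr_fun measurableSet_Icc fun t ht => ?_
  have e : (fun z => {p : ℝ × ℝ | p.2 ≤ p.1}.indicator (fun p => x p.2) (z, t)) =
      (Ici t).indicator fun _ => x t := by
    ext z; simp only [indicator, mem_ofPred_eq, mem_Ici]
  have hne : ∀ᵐ z ∂μ, z ≠ t := by simp [ae_iff, h.measure_singleton]
  have e2 : Ici t =ᵐ[μ] ((Iic t)ᶜ : Set ℝ) := by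
    filter_upwards [hne] with z hz
    have : (t ≤ z) = ¬ (z ≤ t) := by
      rw [not_le, eq_iff_iff]
      exact ⟨fun hle => lt_of_le_of_ne hle hz.symm, le_of_lt⟩
    exact this
  simp only [e]
  rw [integral_indicator_const _ measurableSet_Ici, measureReal_congr e2,
    probReal_compl_eq_one_sub measurableSet_Iic, ← cdf_eq_real, ← mul_assoc,
    h.density_mul_virtualVal ht, smul_eq_mul]

namespace Mechanism

variable {n : ℕ} {Ω : Type*} [MeasurableSpace Ω] {μ : Measure ℝ} {P : Measure Ω} {f : ℝ → ℝ}
  {a b : ℝ} {X : Set (Fin n → ℝ)} {M : Mechanism n Ω}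

theorem mem_Icc_of_eq_zero_or_one {t : ℝ} (ht : t = 0 ∨ t = 1) : t ∈ Icc (0 : ℝ) 1 := by
  rcases ht with rfl | rfl <;> simp

section Alloc

variable [IsProbabilityMeasure μ] [IsProbabilityMeasure P]
  (hm : ∀ i, Measurable fun q : (Fin n → ℝ) × Ω => M.alloc q.1 q.2 i)
  (h01 : ∀ v ω i, M.alloc v ω i ∈ Icc (0 : ℝ) 1)

theorem norm_le_one_of_mem_Icc {t : ℝ} (ht : t ∈ Icc (0 : ℝ) 1) : ‖t‖ ≤ 1 := by
  rw [Real.norm_eq_abs, abs_of_nonneg ht.1]; exact ht.2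

include hm

theorem measurable_interimAlloc (i : Fin n) : Measurable (M.interimAlloc μ P i) :=
  measurable_interim i (hm i)

include h01

theorem integrable_alloc_update (i : Fin n) (z : ℝ) :
    Integrable (fun q : (Fin n → ℝ) × Ω => M.alloc (Function.update q.1 i z) q.2 i)
      (jointLaw n μ P) := by
  refine Integrable.of_bound ?_ 1 (Eventually.of_forall fun q => norm_le_one_of_mem_Icc (h01 _ _ _))
  have hu : Measurable fun q : (Fin n → ℝ) × Ω => (Function.update q.1 i z, q.2) :=
    (measurePreserving_update_jointLaw (μ := μ) (P := P) i).measurable.comp measurable_prodMk_left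
  exact ((hm i).comp hu).aestronglyMeasurable

theorem interimAlloc_mem_Icc (i : Fin n) (z : ℝ) : M.interimAlloc μ P i z ∈ Icc (0 : ℝ) 1 := by
  refine ⟨integral_nonneg fun q => (h01 _ _ _).1, ?_⟩
  calc M.interimAlloc μ P i z ≤ ∫ _, (1 : ℝ) ∂jointLaw n μ P :=
        integral_mono (integrable_alloc_update hm h01 i z) (integrable_const _)
          fun q => (h01 _ _ _).2
    _ = 1 := by simp

theorem integrable_weight_mul_alloc {ψ : ℝ → ℝ} (hψ : Integrable ψ μ) (i : Fin n) :
    Integrable (fun q : (Fin n → ℝ) × Ω => ψ (q.1 i) * M.alloc q.1 q.2 i) (jointLaw n μ P) := by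
  have h1 : Integrable (fun q : (Fin n → ℝ) × Ω => ψ (q.1 i)) (jointLaw n μ P) :=
    (measurePreserving_eval_jointLaw i).integrable_comp_of_integrable hψ
  exact h1.mul_bdd (hm i).aestronglyMeasurable
    (Eventually.of_forall fun q => norm_le_one_of_mem_Icc (h01 _ _ _))

theorem integral_weight_mul_alloc {ψ : ℝ → ℝ} (hψ : Integrable ψ μ) (i : Fin n) :
    ∫ q, ψ (q.1 i) * M.alloc q.1 q.2 i ∂jointLaw n μ P =
      ∫ z, ψ z * M.interimAlloc μ P i z ∂μ := by
  rw [integral_jointLaw_eq i (integrable_weight_mul_alloc hm h01 hψ i)]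
  refine integral_congr_ae (Eventually.of_forall fun z => ?_)
  simp only [Function.update_self]
  rw [integral_const_mul]
  rfl

end Alloc

/-! ### Envelope formula and virtual surplus of admissible mechanisms -/

namespace IsAdmissible

theorem alloc_mem_Icc (hM : M.IsAdmissible μ P a b X) (hX : ∀ x ∈ X, ∀ i, x i = 0 ∨ x i = 1)
    (v : Fin n → ℝ) (ω : Ω) (i : Fin n) : M.alloc v ω i ∈ Icc (0 : ℝ) 1 :=
  mem_Icc_of_eq_zero_or_one (hX _ (hM.feasible v ω) i)

/-- In the sum of the two incentive constraints between `y` and `z` the payments cancel. -/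
theorem monotoneOn_interimAlloc (hM : M.IsAdmissible μ P a b X) (i : Fin n) :
    MonotoneOn (M.interimAlloc μ P i) (Icc a b) := by
  intro y hy z hz hyz
  rcases eq_or_lt_of_le hyz with rfl | hlt
  · exact le_rfl
  have h1 := hM.incentive_compatible i y hy z hz
  have h2 := hM.incentive_compatible i z hz y hy
  unfold interimUtil at h1 h2
  have : (z - y) * (M.interimAlloc μ P i y) ≤ (z - y) * (M.interimAlloc μ P i z) := by linarith
  exact le_of_mul_le_mul_left this (sub_pos.2 hlt)

variable [IsProbabilityMeasure μ] [IsProbabilityMeasure P]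

/-- Interim utility is the primitive of the interim allocation. -/
theorem interimUtil_eq_integral (hM : M.IsAdmissible μ P a b X)
    (hX : ∀ x ∈ X, ∀ i, x i = 0 ∨ x i = 1) (i : Fin n) {z : ℝ} (hz : z ∈ Icc a b) :
    M.interimUtil μ P i z z = ∫ t in a..z, M.interimAlloc μ P i t := by
  have := eq_add_integral_of_subgradient (u := fun z => M.interimUtil μ P i z z)
    (x := M.interimAlloc μ P i) (a := a) (b := b) (fun y hy y' hy' => ?_)
    (interimAlloc_mem_Icc hM.measurable_alloc (hM.alloc_mem_Icc hX) i)
    (hM.monotoneOn_interimAlloc i) hz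
  · rw [hM.lowest_type, zero_add] at this
    exact this
  · have h1 := hM.incentive_compatible i y' hy' y hy
    refine le_trans (le_of_eq ?_) h1
    unfold interimUtil
    ring

theorem integrable_pay_jointLaw (h : IsValuationLaw μ f a b) (hM : M.IsAdmissible μ P a b X)
    (hX : ∀ x ∈ X, ∀ i, x i = 0 ∨ x i = 1) (ha : 0 ≤ a) (i : Fin n) :
    Integrable (fun q : (Fin n → ℝ) × Ω => M.pay q.1 q.2 i) (jointLaw n μ P) := by
  have hmp := measurePreserving_update_jointLaw (μ := μ) (P := P) i
  rw [← hmp.integrable_comp (hM.measurable_pay i).aestronglyMeasurable]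
  rw [integrable_prod_iff ((hM.measurable_pay i).comp hmp.measurable).aestronglyMeasurable]
  refine ⟨?_, ?_⟩
  · filter_upwards [h.ae_mem_Icc] with z hz using hM.integrable_pay i z hz
  · have e : (fun z => ∫ q : (Fin n → ℝ) × Ω, ‖((fun q : (Fin n → ℝ) × Ω => M.pay q.1 q.2 i) ∘
        fun p : ℝ × ((Fin n → ℝ) × Ω) => (Function.update p.2.1 i p.1, p.2.2)) (z, q)‖
          ∂jointLaw n μ P) = M.interimPay μ P i := by
      ext z
      refine integral_congr_ae (Eventually.of_forall fun q => ?_)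
      simp [abs_of_nonneg (hM.pay_nonneg _ _ _)]
    rw [e]
    -- Individual rationality gives `0 ≤ p_i(z) ≤ z x_i(z) ≤ b`.
    refine Integrable.of_bound
      (measurable_interim i (hM.measurable_pay i)).aestronglyMeasurable b ?_
    filter_upwards [h.ae_mem_Icc] with z hz
    have h1 : 0 ≤ M.interimPay μ P i z := integral_nonneg fun q => hM.pay_nonneg _ _ _
    have h2 := hM.individually_rational i z hz
    have h3 := interimAlloc_mem_Icc (μ := μ) (P := P) hM.measurable_alloc (hM.alloc_mem_Icc hX) i z
    unfold interimUtil at h2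
    rw [Real.norm_eq_abs, abs_of_nonneg h1]
    nlinarith [h3.1, h3.2, hz.1, hz.2]

/-- The residual surplus of an admissible mechanism is its expected virtual surplus. -/
theorem residualSurplus_eq (h : IsValuationLaw μ f a b) (hM : M.IsAdmissible μ P a b X)
    (hX : ∀ x ∈ X, ∀ i, x i = 0 ∨ x i = 1) (ha : 0 ≤ a) :
    M.residualSurplus μ P = ∑ i, ∫ z, virtualVal μ f z * M.interimAlloc μ P i z ∂μ := by
  have h01 := hM.alloc_mem_Icc hX
  have hid : Integrable (fun z : ℝ => z) μ := by
    refine Integrable.of_bound measurable_id.aestronglyMeasurable b ?_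
    filter_upwards [h.ae_mem_Icc] with z hz
    rw [Real.norm_eq_abs, abs_of_nonneg (ha.trans hz.1)]
    exact hz.2
  have hint : ∀ i, Integrable (fun q : (Fin n → ℝ) × Ω =>
      q.1 i * M.alloc q.1 q.2 i - M.pay q.1 q.2 i) (jointLaw n μ P) := fun i =>
    (integrable_weight_mul_alloc hM.measurable_alloc h01 hid i).sub
      (integrable_pay_jointLaw h hM hX ha i)
  rw [residualSurplus, integral_finsetSum _ fun i _ => hint i]
  refine Finset.sum_congr rfl fun i _ => ?_
  rw [integral_jointLaw_eq i (hint i), ← h.integral_primitive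
    (measurable_interimAlloc hM.measurable_alloc i)
    (interimAlloc_mem_Icc hM.measurable_alloc h01 i)]
  refine integral_congr_ae ?_
  filter_upwards [h.ae_mem_Icc] with z hz
  rw [← hM.interimUtil_eq_integral hX i hz]
  simp only [Function.update_self]
  rw [integral_sub ((integrable_alloc_update hM.measurable_alloc h01 i z).const_mul z)
    (hM.integrable_pay i z hz), integral_const_mul]
  rfl

/-- The residual surplus is the expected ironed virtual surplus plus a nonpositive correction. -/
theorem residualSurplus_eq_add (h : IsValuationLaw μ f a b) (hM : M.IsAdmissible μ P a b X)
    (hX : ∀ x ∈ X, ∀ i, x i = 0 ∨ x i = 1) (ha : 0 ≤ a) :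
    M.residualSurplus μ P =
      ∫ q, ∑ i, rightIronedVal μ f a b (q.1 i) * M.alloc q.1 q.2 i ∂jointLaw n μ P +
      ∑ i, ∫ z, (virtualVal μ f z - rightIronedVal μ f a b z) * M.interimAlloc μ P i z ∂μ := by
  have h01 := hM.alloc_mem_Icc hX
  rw [residualSurplus_eq h hM hX ha, integral_finsetSum _ fun i _ =>
    integrable_weight_mul_alloc hM.measurable_alloc h01 h.integrable_rightIronedVal i,
    ← Finset.sum_add_distrib]
  refine Finset.sum_congr rfl fun i _ => ?_
  rw [integral_weight_mul_alloc hM.measurable_alloc h01 h.integrable_rightIronedVal i]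
  have hx := measurable_interimAlloc (μ := μ) (P := P) hM.measurable_alloc i
  have hbd : ∀ᵐ z ∂μ, ‖M.interimAlloc μ P i z‖ ≤ 1 := Eventually.of_forall fun z =>
    norm_le_one_of_mem_Icc (interimAlloc_mem_Icc hM.measurable_alloc h01 i z)
  have hgap : Integrable (fun z => (virtualVal μ f z - rightIronedVal μ f a b z) *
      M.interimAlloc μ P i z) μ :=
    (h.integrable_virtualVal.sub h.integrable_rightIronedVal).mul_bdd hx.aestronglyMeasurable hbd
  rw [← integral_add (h.integrable_rightIronedVal.mul_bdd hx.aestronglyMeasurable hbd) hgap]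
  refine integral_congr_ae (Eventually.of_forall fun z => ?_)
  simp only
  ring

end IsAdmissible

end Mechanism

/-! ### Mechanisms with envelope payments -/

namespace Mechanism

variable {n : ℕ} {Ω : Type*} [MeasurableSpace Ω] {μ : Measure ℝ} {P : Measure Ω}
  {a b : ℝ} {X : Set (Fin n → ℝ)}

/-- The mechanism with allocation rule `A` in which every agent makes, as a function of its own
report only, the payment given by the envelope formula. -/
def ofAlloc (A : (Fin n → ℝ) → Ω → Fin n → ℝ) (μ : Measure ℝ) (P : Measure Ω) (a : ℝ) :
    Mechanism n Ω where
  alloc := A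
  -- The truncation at `0` matters only for reports outside `[a, b]`, where nonnegativity is still
  -- required. The interim allocation does not see payments, so `⟨A, 0⟩` avoids circularity.
  pay v _ i := max 0 (v i * interimAlloc ⟨A, 0⟩ μ P i (v i) -
    ∫ t in a..v i, interimAlloc ⟨A, 0⟩ μ P i t)

theorem isAdmissible_ofAlloc [IsProbabilityMeasure μ] [IsProbabilityMeasure P]
    {A : (Fin n → ℝ) → Ω → Fin n → ℝ} (ha : 0 ≤ a)
    (hX : ∀ x ∈ X, ∀ i, x i = 0 ∨ x i = 1)
    (hm : ∀ i, Measurable fun q : (Fin n → ℝ) × Ω => A q.1 q.2 i) (hA : ∀ v ω, A v ω ∈ X)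
    (hmono : ∀ i, MonotoneOn ((ofAlloc A μ P a).interimAlloc μ P i) (Icc a b)) (hab : a ≤ b) :
    (ofAlloc A μ P a).IsAdmissible μ P a b X := by
  set M := ofAlloc A μ P a with hM
  have h01 : ∀ v ω i, M.alloc v ω i ∈ Icc (0 : ℝ) 1 := fun v ω i =>
    mem_Icc_of_eq_zero_or_one (hX _ (hA v ω) i)
  have hxm : ∀ i, Measurable (M.interimAlloc μ P i) := fun i => measurable_interimAlloc hm i
  have hx01 : ∀ i z, M.interimAlloc μ P i z ∈ Icc (0 : ℝ) 1 := fun i z =>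
    interimAlloc_mem_Icc hm h01 i z
  have hint : ∀ i y z, IntervalIntegrable (M.interimAlloc μ P i) volume y z := by
    intro i y z
    refine (intervalIntegrable_const (c := (1 : ℝ))).mono_fun (hxm i).aestronglyMeasurable
      (Eventually.of_forall fun t => ?_)
    simpa using norm_le_one_of_mem_Icc (hx01 i t)
  -- The subgradient inequality for the primitive of a monotone function. It yields incentive
  -- compatibility and, taken at `z = a` with `0 ≤ a`, nonnegative payments.
  have hupper : ∀ i, ∀ y ∈ Icc a b, ∀ z ∈ Icc a b,
      (z - y) * M.interimAlloc μ P i y ≤ ∫ t in y..z, M.interimAlloc μ P i t := by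
    intro i y hy z hz
    rcases le_total y z with hyz | hzy
    · have := intervalIntegral.integral_mono_on hyz (intervalIntegrable_const
        (c := M.interimAlloc μ P i y)) (hint i y z)
        fun t ht => hmono i hy ⟨hy.1.trans ht.1, ht.2.trans hz.2⟩ ht.1
      simpa using this
    · have := intervalIntegral.integral_mono_on hzy (hint i z y) (intervalIntegrable_const
        (c := M.interimAlloc μ P i y))
        fun t ht => hmono i ⟨hz.1.trans ht.1, ht.2.trans hy.2⟩ hy ht.2
      rw [intervalIntegral.integral_symm]
      simp only [intervalIntegral.integral_const, smul_eq_mul] at this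
      linarith
  have hpay : ∀ i, ∀ z ∈ Icc a b, ∀ v : Fin n → ℝ, ∀ ω, M.pay (Function.update v i z) ω i =
      z * M.interimAlloc μ P i z - ∫ t in a..z, M.interimAlloc μ P i t := by
    intro i z hz v ω
    have h1 : M.pay (Function.update v i z) ω i =
        max 0 (z * M.interimAlloc μ P i z - ∫ t in a..z, M.interimAlloc μ P i t) := by
      simp only [hM, ofAlloc, Function.update_self]
      rfl
    rw [h1, max_eq_right]
    have h2 := hupper i z hz a ⟨le_rfl, hab⟩
    rw [intervalIntegral.integral_symm] at h2
    nlinarith [(hx01 i z).1]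
  have hinterim : ∀ i, ∀ z ∈ Icc a b, M.interimPay μ P i z =
      z * M.interimAlloc μ P i z - ∫ t in a..z, M.interimAlloc μ P i t := by
    intro i z hz
    unfold interimPay
    simp_rw [hpay i z hz]
    simp
  have hutil : ∀ i, ∀ z ∈ Icc a b,
      M.interimUtil μ P i z z = ∫ t in a..z, M.interimAlloc μ P i t := by
    intro i z hz
    rw [interimUtil, hinterim i z hz]
    ring
  refine ⟨hm, fun i => ?_, hA, fun v ω i => le_max_left _ _, fun i z hz => ?_,
    fun i z hz z' hz' => ?_, fun i z hz => ?_, fun i => ?_⟩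
  · have hprim : Measurable fun z => ∫ t in a..z, M.interimAlloc μ P i t :=
      (intervalIntegral.continuous_primitive (hint i) a).measurable
    have hv : Measurable fun q : (Fin n → ℝ) × Ω => q.1 i := by fun_prop
    exact measurable_const.max ((hv.mul ((hxm i).comp hv)).sub (hprim.comp hv))
  · simp_rw [hpay i z hz]
    exact integrable_const _
  · rw [hutil i z hz, interimUtil, hinterim i z' hz']
    have h1 := hupper i z' hz' z hz
    have h2 := intervalIntegral.integral_add_adjacent_intervals (hint i a z') (hint i z' z)
    linarith
  · rw [hutil i z hz]
    exact intervalIntegral.integral_nonneg hz.1 fun t _ => (hx01 i t).1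
  · rw [hutil i a ⟨le_rfl, hab⟩, intervalIntegral.integral_same]

end Mechanism

/-! ### Maximizing the ironed virtual surplus pointwise -/

/-- The ironed virtual valuation, set to zero at and below `a`. -/
def ironedScore (μ : Measure ℝ) (f : ℝ → ℝ) (a b z : ℝ) : ℝ :=
  if a < z then rightIronedVal μ f a b z else 0

theorem ironedScore_eq {μ : Measure ℝ} {f : ℝ → ℝ} {a b z : ℝ} (hz : a < z) :
    ironedScore μ f a b z = rightIronedVal μ f a b z := if_pos hz

section Select

variable {n : ℕ} {X : Set (Fin n → ℝ)}

open scoped Classical in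
/-- If some agent is distinguished by `B`, an allocation serving one such agent if possible;
otherwise a maximal element for `R`. -/
def selectAlloc (y₀ : X) (R : X → X → Prop) (B : Fin n → Prop) : X :=
  -- In `ironedAlloc` this is the case of a report of at least `b`: a right derivative at quantile
  -- `1` says nothing about `G` on `[0, 1]`, and serving such an agent keeps the rule monotone up to
  -- `b`.
  if h : ∃ i, B i then
    if h' : ∃ y : X, y.1 h.choose = 1 then h'.choose else y₀
  else if h : ∃ y, ∀ y', R y' y then h.choose else y₀

theorem selectAlloc_apply_eq_one (y₀ : X) (R : X → X → Prop) {B : Fin n → Prop} {i : Fin n}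
    (hB : ∀ j, B j ↔ j = i) (hy : ∃ y : X, y.1 i = 1) : (selectAlloc y₀ R B).1 i = 1 := by
  have h : ∃ j, B j := ⟨i, (hB i).2 rfl⟩
  have hi : h.choose = i := (hB _).1 h.choose_spec
  have h' : ∃ y : X, y.1 h.choose = 1 := by rwa [hi]
  rw [selectAlloc, dif_pos h, dif_pos h']
  exact (congrArg h'.choose.1 hi.symm).trans h'.choose_spec

theorem selectAlloc_maximal (y₀ : X) {R : X → X → Prop} {B : Fin n → Prop} (hB : ∀ j, ¬B j)
    (hR : ∃ y, ∀ y', R y' y) (y : X) : R y (selectAlloc y₀ R B) := by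
  rw [selectAlloc, dif_neg (by simpa using hB), dif_pos hR]
  exact hR.choose_spec y

/-- An allocation maximizing the ironed virtual surplus of the profile `v`; agents reporting at
least `b` are served if possible. -/
def ironedAlloc (μ : Measure ℝ) (f : ℝ → ℝ) (a b : ℝ) (y₀ : X) (v : Fin n → ℝ) : X :=
  selectAlloc y₀ (fun y y' => ∑ i, ironedScore μ f a b (v i) * y.1 i ≤
    ∑ i, ironedScore μ f a b (v i) * y'.1 i) fun i => b ≤ v i

theorem finite_of_forall_eq_zero_or_one (hX : ∀ x ∈ X, ∀ i, x i = 0 ∨ x i = 1) : Finite X := by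
  have h : (univ.pi fun _ : Fin n => ({0, 1} : Set ℝ)).Finite :=
    Set.Finite.pi fun _ => (Set.finite_singleton 1).insert 0
  exact (h.subset fun x hx i _ => hX x hx i).to_subtype

variable {μ : Measure ℝ} {f : ℝ → ℝ} {a b : ℝ}

theorem sum_update_mul (s : ℝ → ℝ) (v : Fin n → ℝ) (i : Fin n) (z z' : ℝ) (y : Fin n → ℝ) :
    ∑ j, s (Function.update v i z' j) * y j =
      ∑ j, s (Function.update v i z j) * y j + (s z' - s z) * y i := by
  rw [← sub_eq_iff_eq_add', ← Finset.sum_sub_distrib, Finset.sum_eq_single i]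
  · simp; ring
  · intro j _ hj
    simp [Function.update_of_ne hj]
  · simp

theorem ironedAlloc_maximal [Finite X] (y₀ : X) {v : Fin n → ℝ} (hv : ∀ j, v j < b) (y : X) :
    ∑ i, ironedScore μ f a b (v i) * y.1 i ≤
      ∑ i, ironedScore μ f a b (v i) * (ironedAlloc μ f a b y₀ v).1 i := by
  have : Nonempty X := ⟨y₀⟩
  exact selectAlloc_maximal y₀ (B := fun i => b ≤ v i)
    (R := fun y y' => ∑ i, ironedScore μ f a b (v i) * y.1 i ≤
      ∑ i, ironedScore μ f a b (v i) * y'.1 i) (fun j => not_le.2 (hv j))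
    (Finite.exists_max fun y : X => ∑ i, ironedScore μ f a b (v i) * y.1 i) y

theorem update_lt {v : Fin n → ℝ} (hv : ∀ j, v j < b) (i : Fin n) {z : ℝ} (hz : z < b)
    (j : Fin n) : Function.update v i z j < b := by
  by_cases hj : j = i
  · subst hj; simpa using hz
  · simpa [Function.update_of_ne hj] using hv j

/-- The selection sees the profile only through `R` and `B`; equal scores leave both unchanged, so
ties are broken identically. -/
theorem ironedAlloc_update_eq (y₀ : X) {v : Fin n → ℝ} (hv : ∀ j, v j < b) (i : Fin n) {z z' : ℝ}
    (hz : z < b) (hz' : z' < b) (heq : ironedScore μ f a b z = ironedScore μ f a b z') :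
    ironedAlloc μ f a b y₀ (Function.update v i z) =
      ironedAlloc μ f a b y₀ (Function.update v i z') := by
  have hs : ∀ y : Fin n → ℝ, ∑ j, ironedScore μ f a b (Function.update v i z' j) * y j =
      ∑ j, ironedScore μ f a b (Function.update v i z j) * y j := fun y => by
    rw [sum_update_mul _ v i z z', heq, sub_self, zero_mul, add_zero]
  have hB : (fun j => b ≤ Function.update v i z j) = fun j => b ≤ Function.update v i z' j := by
    ext j
    exact iff_of_false (not_le.2 (update_lt hv i hz j)) (not_le.2 (update_lt hv i hz' j))
  simp only [ironedAlloc, hs, hB]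

/-- Exchange argument: were agent `i` served at `z` but not at `z'` with a strictly larger score,
optimality of each allocation at its own profile would contradict the other. Equal scores give the
same allocation. -/
theorem ironedAlloc_update_mono [Finite X] (hX : ∀ x ∈ X, ∀ i, x i = 0 ∨ x i = 1) (y₀ : X)
    {v : Fin n → ℝ} (hv : ∀ j, v j < b) (i : Fin n) {z z' : ℝ} (hzz' : z ≤ z') (hz' : z' ≤ b)
    (hscore : z' < b → ironedScore μ f a b z ≤ ironedScore μ f a b z') :
    (ironedAlloc μ f a b y₀ (Function.update v i z)).1 i ≤
      (ironedAlloc μ f a b y₀ (Function.update v i z')).1 i := by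
  set y := ironedAlloc μ f a b y₀ (Function.update v i z) with hy
  set y' := ironedAlloc μ f a b y₀ (Function.update v i z') with hy'
  rcases hX y.1 y.2 i with h0 | h1
  · rw [h0]; exact (Mechanism.mem_Icc_of_eq_zero_or_one (hX y'.1 y'.2 i)).1
  rcases eq_or_lt_of_le hz' with rfl | hlt
  · have : y'.1 i = 1 := by
      refine selectAlloc_apply_eq_one y₀ _ (fun j => ?_) ⟨y, h1⟩
      by_cases hj : j = i
      · subst hj; simp
      · simpa [Function.update_of_ne hj, hj] using hv j
    rw [h1, this]
  rcases eq_or_lt_of_le (hscore hlt) with heq | hslt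
  · rw [hy, hy', ironedAlloc_update_eq y₀ hv i (hzz'.trans_lt hlt) hlt heq]
  · refine not_lt.1 fun hcon => ?_
    have h0 : y'.1 i = 0 := by
      rcases hX y'.1 y'.2 i with h | h
      · exact h
      · rw [h1, h] at hcon; exact absurd hcon (lt_irrefl _)
    have e1 := ironedAlloc_maximal (μ := μ) (f := f) (a := a) y₀
      (update_lt hv i (hzz'.trans_lt hlt)) y'
    have e2 := ironedAlloc_maximal (μ := μ) (f := f) (a := a) y₀ (update_lt hv i hlt) y
    rw [← hy] at e1
    rw [← hy', sum_update_mul _ v i z z', sum_update_mul _ v i z z' y'.1, h1, h0] at e2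
    linarith

/-- The selection factors through the finite discrete space of pairs `(R, B)`, so any choice made
there is measurable. -/
theorem measurable_ironedAlloc [Finite X] [IsProbabilityMeasure μ] (h : IsValuationLaw μ f a b)
    (y₀ : X) : Measurable (ironedAlloc μ f a b y₀) := by
  have hs : Measurable (ironedScore μ f a b) :=
    Measurable.ite measurableSet_Ioi h.measurable_rightIronedVal measurable_const
  have hsum : ∀ y : X, Measurable fun v : Fin n → ℝ => ∑ i, ironedScore μ f a b (v i) * y.1 i :=
    fun y => Finset.measurable_sum _ fun i _ =>
      (hs.comp (measurable_pi_apply i)).mul_const _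
  have hR : Measurable fun v : Fin n → ℝ => (fun y y' : X =>
      ∑ i, ironedScore μ f a b (v i) * y.1 i ≤ ∑ i, ironedScore μ f a b (v i) * y'.1 i) :=
    measurable_pi_iff.2 fun y => measurable_pi_iff.2 fun y' =>
      measurableSet_setOfPred.1 (measurableSet_le (hsum y) (hsum y'))
  have hB : Measurable fun v : Fin n → ℝ => (fun i => b ≤ v i) :=
    measurable_pi_iff.2 fun i =>
      measurableSet_setOfPred.1 (measurableSet_le measurable_const (measurable_pi_apply i))
  exact (Measurable.of_discrete (f := fun p : (X → X → Prop) × (Fin n → Prop) =>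
    selectAlloc y₀ p.1 p.2)).comp (hR.prodMk hB)

end Select

/-! ### Characterization of the optimal mechanisms -/

namespace IsValuationLaw

variable {μ : Measure ℝ} {f : ℝ → ℝ} {a b : ℝ} [IsProbabilityMeasure μ]

/-- The value `0` assigned at and below `a` fits because the ironed valuation is nonnegative on `(a,
b)`. -/
theorem ironedScore_mono (h : IsValuationLaw μ f a b) {z z' : ℝ} (hzz' : z ≤ z') (hz' : z' < b) :
    ironedScore μ f a b z ≤ ironedScore μ f a b z' := by
  unfold ironedScore
  split_ifs with h1 h2 h2
  · exact h.monotoneOn_rightIronedVal ⟨h1, hzz'.trans_lt hz'⟩ ⟨h2, hz'⟩ hzz'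
  · exact absurd (h1.trans_le hzz') h2
  · exact h.rightIronedVal_nonneg ⟨h2, hz'⟩
  · exact le_rfl

end IsValuationLaw

namespace Mechanism

variable {n : ℕ} {Ω : Type*} [MeasurableSpace Ω] {μ : Measure ℝ} {P : Measure Ω} {f : ℝ → ℝ}
  {a b : ℝ} {X : Set (Fin n → ℝ)} [IsProbabilityMeasure μ] [IsProbabilityMeasure P]

/-- Some admissible mechanism maximizes the ironed virtual surplus pointwise and attains it as
residual surplus. -/
theorem exists_isAdmissible_residualSurplus_eq (h : IsValuationLaw μ f a b) (ha : 0 ≤ a)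
    (hX : ∀ x ∈ X, ∀ i, x i = 0 ∨ x i = 1) (hne : X.Nonempty) :
    ∃ M : Mechanism n Ω, M.IsAdmissible μ P a b X ∧
      M.residualSurplus μ P =
        ∫ q, ∑ i, rightIronedVal μ f a b (q.1 i) * M.alloc q.1 q.2 i ∂jointLaw n μ P ∧
      ∀ᵐ q ∂jointLaw n μ P, ∀ y ∈ X, ∑ i, rightIronedVal μ f a b (q.1 i) * y i ≤
        ∑ i, rightIronedVal μ f a b (q.1 i) * M.alloc q.1 q.2 i := by
  obtain ⟨y, hy⟩ := hne
  set y₀ : X := ⟨y, hy⟩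
  have : Finite X := finite_of_forall_eq_zero_or_one hX
  set A : (Fin n → ℝ) → Ω → Fin n → ℝ := fun v _ => (ironedAlloc μ f a b y₀ v).1 with hA
  set M := ofAlloc A μ P a with hM
  have hae : ∀ᵐ q ∂jointLaw n μ P, ∀ i, q.1 i ∈ Ioo a b := ae_jointLaw_of_ae h.ae_mem_Ioo
  have hm : ∀ i, Measurable fun q : (Fin n → ℝ) × Ω => A q.1 q.2 i := fun i =>
    (measurable_pi_apply i).comp
      (measurable_subtype_coe.comp ((measurable_ironedAlloc h y₀).comp measurable_fst))
  have hAX : ∀ v ω, A v ω ∈ X := fun v ω => (ironedAlloc μ f a b y₀ v).2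
  have h01 : ∀ v ω i, M.alloc v ω i ∈ Icc (0 : ℝ) 1 := fun v ω i =>
    mem_Icc_of_eq_zero_or_one (hX _ (hAX v ω) i)
  have hmono : ∀ i, MonotoneOn (M.interimAlloc μ P i) (Icc a b) := by
    intro i z hz z' hz' hzz'
    refine integral_mono_ae (integrable_alloc_update hm h01 i z)
      (integrable_alloc_update hm h01 i z') ?_
    filter_upwards [hae] with q hq
    exact ironedAlloc_update_mono hX y₀ (fun j => (hq j).2) i hzz' hz'.2
      (h.ironedScore_mono hzz')
  have hadm : M.IsAdmissible μ P a b X := isAdmissible_ofAlloc ha hX hm hAX hmono h.lt.le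
  refine ⟨M, hadm, ?_, ?_⟩
  · rw [IsAdmissible.residualSurplus_eq_add h hadm hX ha, Finset.sum_eq_zero, add_zero]
    intro i _
    refine h.integral_virtualVal_sub_mul_eq_zero (measurable_interimAlloc hm i) (hmono i)
      (interimAlloc_mem_Icc hm h01 i) fun z hz hgap => ?_
    have hzo := h.mem_Ioo_of_ironingGap_pos hz hgap
    -- Where the gap is positive the score is locally constant, hence so are the selected allocation
    -- and its interim expectation.
    filter_upwards [h.eventually_rightIronedVal_eq hzo hgap, Ioo_mem_nhds hzo.1 hzo.2]
      with z' heq hz'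
    refine integral_congr_ae ?_
    filter_upwards [hae] with q hq
    have hs : ironedScore μ f a b z' = ironedScore μ f a b z := by
      rw [ironedScore_eq hz'.1, ironedScore_eq hzo.1, heq]
    simp only [hM, ofAlloc, hA]
    rw [ironedAlloc_update_eq y₀ (fun j => (hq j).2) i hz'.2 hzo.2 hs]
  · filter_upwards [hae] with q hq y hy
    have := ironedAlloc_maximal (μ := μ) (f := f) (a := a) y₀ (fun j => (hq j).2) ⟨y, hy⟩
    simp only [fun i => ironedScore_eq (μ := μ) (f := f) (b := b) (hq i).1] at this
    exact this

theorem IsAdmissible.integrable_ironed_surplus {M : Mechanism n Ω} (h : IsValuationLaw μ f a b)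
    (hM : M.IsAdmissible μ P a b X) (hX : ∀ x ∈ X, ∀ i, x i = 0 ∨ x i = 1) :
    Integrable (fun q : (Fin n → ℝ) × Ω =>
      ∑ i, rightIronedVal μ f a b (q.1 i) * M.alloc q.1 q.2 i) (jointLaw n μ P) :=
  integrable_finsetSum _ fun i _ => integrable_weight_mul_alloc hM.measurable_alloc
    (hM.alloc_mem_Icc hX) h.integrable_rightIronedVal i

theorem IsAdmissible.integral_correction_nonpos {M : Mechanism n Ω} (h : IsValuationLaw μ f a b)
    (hM : M.IsAdmissible μ P a b X) (hX : ∀ x ∈ X, ∀ i, x i = 0 ∨ x i = 1) (i : Fin n) :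
    ∫ z, (virtualVal μ f z - rightIronedVal μ f a b z) * M.interimAlloc μ P i z ∂μ ≤ 0 :=
  h.integral_virtualVal_sub_mul_nonpos (measurable_interimAlloc hM.measurable_alloc i)
    (hM.monotoneOn_interimAlloc i)
    (interimAlloc_mem_Icc hM.measurable_alloc (hM.alloc_mem_Icc hX) i)

/-- A function with zero derivative where the gap is positive is locally constant there. -/
theorem eventually_eq_of_hasDerivAt_zero (h : IsValuationLaw μ f a b) {x : ℝ → ℝ}
    (hx : ∀ z ∈ Icc a b, 0 < ironingGap μ f a b z → HasDerivAt x 0 z) {z : ℝ}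
    (hz : z ∈ Icc a b) (hgap : 0 < ironingGap μ f a b z) : ∀ᶠ y in 𝓝 z, x y = x z := by
  have hzo := h.mem_Ioo_of_ironingGap_pos hz hgap
  have hev : ∀ᶠ y in 𝓝 z, 0 < ironingGap μ f a b y ∧ y ∈ Ioo a b :=
    (h.continuous_ironingGap.continuousAt.eventually (lt_mem_nhds hgap)).and
      (Ioo_mem_nhds hzo.1 hzo.2)
  obtain ⟨ε, hε, hball⟩ := Metric.eventually_nhds_iff_ball.1 hev
  have hd : ∀ y ∈ Metric.ball z ε, HasDerivAt x 0 y := fun y hy =>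
    hx y (Ioo_subset_Icc_self (hball y hy).2) (hball y hy).1
  filter_upwards [Metric.ball_mem_nhds z hε] with y hy
  refine (convex_ball z ε).is_const_of_fderivWithin_eq_zero (𝕜 := ℝ)
    (fun w hw => (hd w hw).differentiableAt.differentiableWithinAt) (fun w hw => ?_) hy
    (Metric.mem_ball_self hε)
  rw [fderivWithin_of_isOpen Metric.isOpen_ball hw]
  ext
  simp [(hd w hw).deriv]

end Mechanism

end MoneyBurning

end

/-! ### The characterization theorem -/

open MoneyBurning MoneyBurning.Mechanism in
theorem theoremt {n : ℕ} {Ω : Type*} [MeasurableSpace Ω]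
    (P : MeasureTheory.Measure Ω) [MeasureTheory.IsProbabilityMeasure P]
    (a b : ℝ) (ha : 0 ≤ a) (hab : a < b)
    (f : ℝ → ℝ) (hf : Measurable f) (hpos : ∀ z ∈ Set.Icc a b, 0 < f z)
    (μ : MeasureTheory.Measure ℝ) [MeasureTheory.IsProbabilityMeasure μ]
    (hμ : μ = (MeasureTheory.volume.restrict (Set.Icc a b)).withDensity
      (fun z => ENNReal.ofReal (f z)))
    (X : Set (Fin n → ℝ)) (hX : ∀ x ∈ X, ∀ i, x i = 0 ∨ x i = 1)
    (M : MoneyBurning.Mechanism n Ω) :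
    M.IsOptimal μ P a b X ↔
      M.IsAdmissible μ P a b X ∧
      (∀ᵐ q ∂(MoneyBurning.Mechanism.jointLaw n μ P),
        M.alloc q.1 q.2 ∈ X ∧
        ∀ y ∈ X, ∑ i, MoneyBurning.ironedVal μ f a b (q.1 i) * y i ≤
          ∑ i, MoneyBurning.ironedVal μ f a b (q.1 i) * M.alloc q.1 q.2 i) ∧
      (∀ i, ∀ z ∈ Set.Icc a b,
        MoneyBurning.GFun μ f a b (ProbabilityTheory.cdf μ z) <
            MoneyBurning.HFun μ f a b (ProbabilityTheory.cdf μ z) →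
          HasDerivAt (M.interimAlloc μ P i) 0 z) := by
  have h : IsValuationLaw μ f a b := ⟨hab, hf, hpos, hμ⟩
  have hval : ∀ᵐ q ∂jointLaw n μ P, ∀ i,
      ironedVal μ f a b (q.1 i) = rightIronedVal μ f a b (q.1 i) :=
    ae_jointLaw_of_ae (h.ae_mem_Ioo.mono fun z hz => h.ironedVal_eq hz)
  constructor
  · rintro ⟨hM, hopt⟩
    -- A probability space is nonempty, so feasibility of `M` supplies an element of `X`.
    obtain ⟨⟨v, ω⟩⟩ : Nonempty ((Fin n → ℝ) × Ω) := nonempty_of_isProbabilityMeasure (jointLaw n μ P)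
    obtain ⟨M', hM', hs', hmax⟩ := exists_isAdmissible_residualSurplus_eq (P := P) h ha hX
      ⟨_, hM.feasible v ω⟩
    -- Sandwich: the ironed surplus of `M'` is at most that of `M` plus nonpositive corrections, and
    -- at least that of `M`. Hence the two ironed surpluses agree and every correction vanishes.
    have hle := hopt M' hM'
    rw [hs', IsAdmissible.residualSurplus_eq_add h hM hX ha] at hle
    have hI := hM.integrable_ironed_surplus h hX
    have hI' := hM'.integrable_ironed_surplus h hX
    have hpt : ∀ᵐ q ∂jointLaw n μ P,
        ∑ i, rightIronedVal μ f a b (q.1 i) * M.alloc q.1 q.2 i ≤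
          ∑ i, rightIronedVal μ f a b (q.1 i) * M'.alloc q.1 q.2 i := by
      filter_upwards [hmax] with q hq using hq _ (hM.feasible _ _)
    have hV := integral_mono_ae hI hI' hpt
    have hcorr : ∀ i, _ := hM.integral_correction_nonpos h hX
    have hsum := Finset.sum_nonpos fun i (_ : i ∈ Finset.univ) => hcorr i
    refine ⟨hM, ?_, fun i z hz hlt => ?_⟩
    · have heq := (integral_eq_iff_of_ae_le hI hI' hpt).1 (by linarith)
      filter_upwards [heq, hmax, hval] with q hq1 hq2 hq3
      refine ⟨hM.feasible _ _, fun y hy => ?_⟩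
      simp only [hq3]
      exact (hq2 y hy).trans_eq hq1.symm
    · have hzero := (Finset.sum_eq_zero_iff_of_nonpos fun i _ => hcorr i).1
        (by linarith) i (Finset.mem_univ i)
      have hev := h.eventually_eq_of_integral_virtualVal_sub_mul_eq_zero
        (measurable_interimAlloc hM.measurable_alloc i) (hM.monotoneOn_interimAlloc i)
        (interimAlloc_mem_Icc hM.measurable_alloc (hM.alloc_mem_Icc hX) i) hzero hz (sub_pos.2 hlt)
      exact (hasDerivAt_const z _).congr_of_eventuallyEq hev
  · rintro ⟨hM, hmax, hder⟩
    refine ⟨hM, fun M' hM' => ?_⟩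
    have hzero : ∀ i, ∫ z, (virtualVal μ f z - rightIronedVal μ f a b z) *
        M.interimAlloc μ P i z ∂μ = 0 := fun i =>
      h.integral_virtualVal_sub_mul_eq_zero (measurable_interimAlloc hM.measurable_alloc i)
        (hM.monotoneOn_interimAlloc i)
        (interimAlloc_mem_Icc hM.measurable_alloc (hM.alloc_mem_Icc hX) i)
        fun z hz hgap => eventually_eq_of_hasDerivAt_zero h
          (fun y hy hgy => hder i y hy (sub_pos.1 hgy)) hz hgap
    rw [IsAdmissible.residualSurplus_eq_add h hM hX ha,
      IsAdmissible.residualSurplus_eq_add h hM' hX ha, Finset.sum_eq_zero fun i _ => hzero i]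
    refine add_le_add (integral_mono_ae (hM'.integrable_ironed_surplus h hX)
      (hM.integrable_ironed_surplus h hX) ?_)
      (Finset.sum_nonpos fun i _ => hM'.integral_correction_nonpos h hX i)
    filter_upwards [hmax, hval] with q hq1 hq2
    have := hq1.2 _ (hM'.feasible q.1 q.2)
    simpa only [hq2] using this
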